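/- Let $q$ be a power of an odd prime, $\mathbb F_q$ the field with $q$ elements, $a$ a generator of the cyclic group $\mathbb F_q^\times$, and $n\ge 1$. Let $M$ be the multiplicative monoid of $n\times n$ matrices over $\mathbb F_q$, with elementary matrices $E_{i,j}$, let $U\subset M$ be the group of upper unitriangular matrices, and let $\mathcal Q\subset M$ be the submonoid of matrices with at most one nonzero entry in each row and in each column. For $\sigma\in\mathcal Q$ of rank $r$ put $$T_\sigma=q^{\frac{r(1-r)}2}\sum_{x\in U\sigma U}x\in\mathbb Q[M],$$ where $\mathbb Q[M]$ is the monoid algebra of $M$, and let $H(M,U)=\bigoplus_{\sigma\in\mathcal Q}\mathbb Z\,T_\sigma\subset\mathbb Q[M]$ be the $\mathbb Z$-submodule spanned by the $T_\sigma$ (the framed rook algebra). For $1\le i\le n-1$ let $s_i$ be the permutation matrix of the transposition $(i\ \,i+1)$, for $1\le i\le n$ let $a_i=1+(a-1)E_{i,i}$, and let $\nu=E_{1,2}+\cdots+E_{n-1,n}$. Write $T_i=T_{s_i}$, $F_i=T_{a_i}$, $N=T_\nu$, and, for $1\le i\le n-1$, $$E_i=\frac1{q-1}\sum_{k=0}^{q-2}F_i^kF_{i+1}^{-k}.$$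 Here powers and inverses are taken in the ring $\varepsilon\,\mathbb Q[M]\,\varepsilon$ with unit $\varepsilon=|U|^{-1}\sum_{u\in U}u$, which contains $H(M,U)$. Then $\varepsilon$ equals $T_\sigma$ for $\sigma$ the identity matrix, and $H(M,U)$ is a ring with this unit (denoted $1$ below): it is the unital subring of $\varepsilon\,\mathbb Q[M]\,\varepsilon$ generated by $T_1,\dots,T_{n-1},F_1,\dots,F_n$ and $N$ (so it is generated by these elements as a $\mathbb Z$-algebra). Moreover, the following relations hold, for all indices for which the generators involved are defined ($T_i$ for $1\le i\le n-1$, $F_i$ for $1\le i\le n$), where $js_i$ denotes the image of $j$ under the transposition $(i\ \,i+1)$: - $T_iT_jT_i=T_jT_iT_j$ if $|i-j|=1$, and $T_iT_j=T_jT_i$ if $|i-j|>1$; - $F_i^{q-1}=1$ and $F_iF_j=F_jF_i$; - $T_i^2=q+(q-1)F_i^{\frac{q-1}2}E_iT_i$ and $T_iF_j=F_{js_i}T_i$; - $F_iN=NF_{i+1}$ for $i<n$, and $NF_1=F_nN=N$; - $N^{i+1}T_i=qN^{i+1}$ and $T_iN^{n-i+1}=qN^{n-i+1}$; - $T_iN=NT_{i+1}$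 for $1\le i\le n-2$, and $NT_1\cdots T_{n-1}N=q^{n-1}N$. -/

import Mathlib

namespace FramedRook

open Matrix

noncomputable section

/-- The group `U` of upper unitriangular matrices, as a submonoid of the monoid `M` of all
`n × n` matrices over `K`. -/
def unitriangular (n : ℕ) (K : Type*) [Field K] : Submonoid (Matrix (Fin n) (Fin n) K) where
  carrier := {A | (∀ i, A i i = 1) ∧ ∀ i j, j < i → A i j = 0}
  one_mem' := ⟨fun i => by simp, fun i j h => by simp [h.ne']⟩
  mul_mem' := by
    rintro A B ⟨hA1, hA0⟩ ⟨hB1, hB0⟩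
    refine ⟨fun i => ?_, fun i j h => ?_⟩
    · rw [Matrix.mul_apply, Finset.sum_eq_single i, hA1, hB1, mul_one]
      · intro k _ hk
        rcases lt_or_gt_of_ne hk with h | h
        · rw [hA0 i k h, zero_mul]
        · rw [hB0 k i h, mul_zero]
      · simp
    · rw [Matrix.mul_apply]
      refine Finset.sum_eq_zero fun k _ => ?_
      rcases lt_or_ge k i with h1 | h1
      · rw [hA0 i k h1, zero_mul]
      · rw [hB0 k j (lt_of_lt_of_le h h1), mul_zero]

/-- The generalized rook monoid `𝒬`: the matrices having at most one nonzero entry in each row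
and in each column. -/
def rookMonoid (n : ℕ) (K : Type*) [Field K] : Submonoid (Matrix (Fin n) (Fin n) K) where
  carrier := {A | (∀ i j j', A i j ≠ 0 → A i j' ≠ 0 → j = j') ∧
    ∀ i i' j, A i j ≠ 0 → A i' j ≠ 0 → i = i'}
  one_mem' := by
    refine ⟨fun i j j' h h' => ?_, fun i i' j h h' => ?_⟩
    · simp only [Matrix.one_apply, ne_eq, ite_eq_right_iff, one_ne_zero, imp_false,
        not_not] at h h'
      exact h.symm.trans h'
    · simp only [Matrix.one_apply, ne_eq, ite_eq_right_iff, one_ne_zero, imp_false,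
        not_not] at h h'
      exact h.trans h'.symm
  mul_mem' := by
    have key : ∀ (A B : Matrix (Fin n) (Fin n) K) (i j : Fin n), (A * B) i j ≠ 0 →
        ∃ k, A i k ≠ 0 ∧ B k j ≠ 0 := by
      intro A B i j h
      rw [Matrix.mul_apply] at h
      obtain ⟨k, -, hk⟩ := Finset.exists_ne_zero_of_sum_ne_zero h
      exact ⟨k, left_ne_zero_of_mul hk, right_ne_zero_of_mul hk⟩
    rintro A B ⟨hA, hA'⟩ ⟨hB, hB'⟩
    refine ⟨fun i j j' h h' => ?_, fun i i' j h h' => ?_⟩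
    · obtain ⟨k, h1, h2⟩ := key A B i j h
      obtain ⟨k', h1', h2'⟩ := key A B i j' h'
      obtain rfl := hA i k k' h1 h1'
      exact hB k j j' h2 h2'
    · obtain ⟨k, h1, h2⟩ := key A B i j h
      obtain ⟨k', h1', h2'⟩ := key A B i' j h'
      obtain rfl := hB' k k' j h2 h2'
      exact hA' i i' k h1 h1'

/-- The double class `U σ U`. -/
def doubleClass {n : ℕ} {K : Type*} [Field K] (σ : Matrix (Fin n) (Fin n) K) :
    Set (Matrix (Fin n) (Fin n) K) :=
  {x | ∃ u ∈ unitriangular n K, ∃ v ∈ unitriangular n K, x = u * σ * v}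

theorem isUnit_of_mem {n : ℕ} {K : Type*} [Field K]
    {u : Matrix (Fin n) (Fin n) K} (hu : u ∈ unitriangular n K) :
    IsUnit u := by
  rw [Matrix.isUnit_iff_isUnit_det, Matrix.det_of_isUpperTriangular (fun i j h => hu.2 i j h)]
  simp [hu.1]

section Finite

variable {n : ℕ} {K : Type*} [Field K] [Fintype K]

/-- The sum of the elements of a set of matrices, in the monoid algebra `ℚ[M]`. -/
def setSum (S : Set (Matrix (Fin n) (Fin n) K)) : MonoidAlgebra ℚ (Matrix (Fin n) (Fin n) K) :=
  ∑ x ∈ S.toFinite.toFinset, MonoidAlgebra.single x 1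

variable (n K) in
/-- The idempotent `ε = |U|⁻¹ ∑_{u ∈ U} u` of `ℚ[M]`. -/
def unipIdem : MonoidAlgebra ℚ (Matrix (Fin n) (Fin n) K) :=
  (Nat.card (unitriangular n K) : ℚ)⁻¹ •
    setSum (unitriangular n K : Set (Matrix (Fin n) (Fin n) K))

theorem single_mul_setSum {S : Set (Matrix (Fin n) (Fin n) K)} {u : Matrix (Fin n) (Fin n) K}
    (hu : IsUnit u) (hS : ∀ x ∈ S, u * x ∈ S) :
    MonoidAlgebra.single u 1 * setSum S = setSum S := by
  classical
  have hi : Function.Injective (fun x => u * x) := fun x y h => hu.mul_left_cancel h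
  unfold setSum
  rw [Finset.mul_sum]
  simp only [MonoidAlgebra.single_mul_single, mul_one]
  rw [← Finset.sum_image (g := fun x => u * x)
    (f := fun x => (MonoidAlgebra.single x 1 : MonoidAlgebra ℚ (Matrix (Fin n) (Fin n) K)))
    hi.injOn]
  congr 1
  refine Finset.eq_of_subset_of_card_le ?_ ?_
  · intro x hx
    obtain ⟨y, hy, rfl⟩ := Finset.mem_image.1 hx
    simpa using hS y (by simpa using hy)
  · rw [Finset.card_image_of_injective _ hi]

theorem setSum_mul_single {S : Set (Matrix (Fin n) (Fin n) K)} {u : Matrix (Fin n) (Fin n) K}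
    (hu : IsUnit u) (hS : ∀ x ∈ S, x * u ∈ S) :
    setSum S * MonoidAlgebra.single u 1 = setSum S := by
  classical
  have hi : Function.Injective (fun x => x * u) := fun x y h => hu.mul_right_cancel h
  unfold setSum
  rw [Finset.sum_mul]
  simp only [MonoidAlgebra.single_mul_single, mul_one]
  rw [← Finset.sum_image (g := fun x => x * u)
    (f := fun x => (MonoidAlgebra.single x 1 : MonoidAlgebra ℚ (Matrix (Fin n) (Fin n) K)))
    hi.injOn]
  congr 1
  refine Finset.eq_of_subset_of_card_le ?_ ?_
  · intro x hx
    obtain ⟨y, hy, rfl⟩ := Finset.mem_image.1 hx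
    simpa using hS y (by simpa using hy)
  · rw [Finset.card_image_of_injective _ hi]

theorem card_ne_zero : (Nat.card (unitriangular n K) : ℚ) ≠ 0 :=
  Nat.cast_ne_zero.2 Nat.card_pos.ne'

theorem card_toFinset :
    (unitriangular n K : Set (Matrix (Fin n) (Fin n) K)).toFinite.toFinset.card =
      Nat.card (unitriangular n K) :=
  (Nat.card_eq_card_finite_toFinset _).symm

theorem unipIdem_mul_setSum {S : Set (Matrix (Fin n) (Fin n) K)}
    (hS : ∀ u ∈ unitriangular n K, ∀ x ∈ S, u * x ∈ S) :
    unipIdem n K * setSum S = setSum S := by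
  have h : setSum (unitriangular n K : Set (Matrix (Fin n) (Fin n) K)) * setSum S =
      (Nat.card (unitriangular n K) : ℚ) • setSum S := by
    conv_lhs => rw [setSum, Finset.sum_mul]
    rw [Finset.sum_congr rfl (g := fun _ => setSum S), Finset.sum_const, card_toFinset,
      Nat.cast_smul_eq_nsmul]
    intro u hu
    have hu' : u ∈ unitriangular n K := by simpa using hu
    exact single_mul_setSum (isUnit_of_mem hu') (hS u hu')
  rw [unipIdem, smul_mul_assoc, h, inv_smul_smul₀ card_ne_zero]

theorem setSum_mul_unipIdem {S : Set (Matrix (Fin n) (Fin n) K)}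
    (hS : ∀ u ∈ unitriangular n K, ∀ x ∈ S, x * u ∈ S) :
    setSum S * unipIdem n K = setSum S := by
  have h : setSum S * setSum (unitriangular n K : Set (Matrix (Fin n) (Fin n) K)) =
      (Nat.card (unitriangular n K) : ℚ) • setSum S := by
    conv_lhs =>
      rw [setSum.eq_1 (unitriangular n K : Set (Matrix (Fin n) (Fin n) K)), Finset.mul_sum]
    rw [Finset.sum_congr rfl (g := fun _ => setSum S), Finset.sum_const, card_toFinset,
      Nat.cast_smul_eq_nsmul]
    intro u hu
    have hu' : u ∈ unitriangular n K := by simpa using hu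
    exact setSum_mul_single (isUnit_of_mem hu') (hS u hu')
  rw [unipIdem, mul_smul_comm, h, inv_smul_smul₀ card_ne_zero]

variable (n K) in
theorem isIdempotentElem_unipIdem : IsIdempotentElem (unipIdem n K) := by
  have h := unipIdem_mul_setSum (S := (unitriangular n K : Set (Matrix (Fin n) (Fin n) K)))
    (fun u hu x hx => mul_mem hu hx)
  rw [IsIdempotentElem]
  nth_rewrite 2 [unipIdem]
  rw [mul_smul_comm, h, ← unipIdem]

variable (n K) in
/-- The ring `ε ℚ[M] ε`, with unit `ε`, in which the framed rook algebra lives. -/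
abbrev Ambient : Type _ := (isIdempotentElem_unipIdem n K).Corner

/-- `ε ℚ[M] ε` is a `ℚ`-algebra, with the scalar multiplication of `ℚ[M]`. -/
instance ambientModule : Module ℚ (Ambient n K) where
  smul c x := ⟨c • x.1, by
    obtain ⟨y, hy⟩ := x.2
    exact ⟨c • y, by simp only [mul_smul_comm, smul_mul_assoc]; exact congrArg (c • ·) hy⟩⟩
  one_smul x := Subtype.ext (one_smul ℚ x.1)
  mul_smul c d x := Subtype.ext (mul_smul c d x.1)
  smul_zero c := Subtype.ext (smul_zero c)
  smul_add c x y := Subtype.ext (smul_add c x.1 y.1)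
  add_smul c d x := Subtype.ext (add_smul c d x.1)
  zero_smul x := Subtype.ext (zero_smul ℚ x.1)

instance ambientAlgebra : Algebra ℚ (Ambient n K) :=
  Algebra.ofModule (fun c x y => Subtype.ext (smul_mul_assoc c x.1 y.1))
    (fun c x y => Subtype.ext (mul_smul_comm c x.1 y.1))

/-- The element `T_σ = q^{r(1-r)/2} ∑_{x ∈ UσU} x`, where `r` is the rank of `σ`. -/
def T (σ : Matrix (Fin n) (Fin n) K) : Ambient n K :=
  ⟨((Fintype.card K : ℚ) ^ (σ.rank * (σ.rank - 1) / 2))⁻¹ • setSum (doubleClass σ), by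
    rw [Subsemigroup.mem_corner_iff (isIdempotentElem_unipIdem n K)]
    constructor
    · rw [mul_smul_comm, unipIdem_mul_setSum]
      rintro w hw _ ⟨u, hu, v, hv, rfl⟩
      exact ⟨w * u, mul_mem hw hu, v, hv, by simp only [mul_assoc]⟩
    · rw [smul_mul_assoc, setSum_mul_unipIdem]
      rintro w hw _ ⟨u, hu, v, hv, rfl⟩
      exact ⟨u, hu, v * w, mul_mem hv hw, by simp only [mul_assoc]⟩⟩

variable (n K) in
/-- The framed rook algebra `H(M,U) = ⨁_{σ ∈ 𝒬} ℤ T_σ`, as a `ℤ`-submodule of `ε ℚ[M] ε`. -/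
def framedRook : Submodule ℤ (Ambient n K) :=
  Submodule.span ℤ (T '' (rookMonoid n K : Set (Matrix (Fin n) (Fin n) K)))

end Finite

section Matrices

variable (n : ℕ) (K : Type*) [Field K]

/-! Row and column indices are numbered from `1` to `n`: the index `p : Fin n` stands for the
number `p + 1`. -/

/-- The permutation matrix `s_i` of the transposition exchanging `i` and `i + 1`. -/
def sMat (i : ℕ) : Matrix (Fin n) (Fin n) K :=
  Matrix.of fun p r => if Equiv.swap i (i + 1) (p.val + 1) = r.val + 1 then 1 else 0

/-- The diagonal matrix `a_i = 1 + (a - 1) E_{i,i}`. -/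
def aMat {K : Type*} [Field K] (a : Kˣ) (i : ℕ) : Matrix (Fin n) (Fin n) K :=
  Matrix.diagonal fun p => if p.val + 1 = i then (a : K) else 1

/-- The matrix `ν = E_{1,2} + ⋯ + E_{n-1,n}`. -/
def nuMat : Matrix (Fin n) (Fin n) K :=
  Matrix.of fun p r => if (p.val + 1) + 1 = r.val + 1 then 1 else 0

end Matrices

section Generators

variable (n : ℕ) (K : Type*) [Field K] [Fintype K]

/-- `T_i = T_{s_i}`. -/
def genT (i : ℕ) : Ambient n K := T (sMat n K i)

/-- `F_i = T_{a_i}`. -/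
def genF {K : Type*} [Field K] [Fintype K] (a : Kˣ) (i : ℕ) : Ambient n K := T (aMat n a i)

/-- `N = T_ν`. -/
def genN : Ambient n K := T (nuMat n K)

/-- `E_i = (q - 1)⁻¹ ∑_{k=0}^{q-2} F_i^k F_{i+1}^{-k}`. The inverse is the two-sided inverse in
`ε ℚ[M] ε` (whose unit is `ε`). -/
def elemE {K : Type*} [Field K] [Fintype K] (a : Kˣ) (i : ℕ) : Ambient n K :=
  ((Fintype.card K : ℚ) - 1)⁻¹ • ∑ k ∈ Finset.range (Fintype.card K - 1),
    genF n a i ^ k * Ring.inverse (genF n a (i + 1)) ^ k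

end Generators

end

end FramedRook

namespace FramedRook

open Matrix

noncomputable section

/-! ### The elements εxε and their products -/

section

variable {n : ℕ} {K : Type*} [Field K]

/-! Every `T σ` is a scalar `scal σ` times `bi σ` = εσε, so the proof separates products of the
elements εσε from the computation of the scalars. A product εx·εyε is the average of εxuyε over u in
U. If xU ⊆ Ux, as for ν and for invertible diagonal matrices, it is simply ε(xy)ε. For an adjacent
transposition s only the (i, j) entry of u matters, which leaves an average over q transvections.
When `RowAscent σ i j` holds, each transvection passes through σ and is absorbed by ε. Otherwise the
nonzero parameters are handled by the rank one Bruhat decomposition, which produces the diagonal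
terms of the quadratic relation.

The scalars come from |UσU| = q^|`reach σ`| (`card_doubleClass`): by orbit-stabilizer this is the
size of the range of the linear map (m, m') ↦ mσ - σm'. Multiplication by s in the ascent case
enlarges the reach by one if row i is nonzero. Multiplication by ν deletes its first row, which has
at least r - 1 positions. This is what the normalization by q^{r(r-1)/2} needs for `genN n K * T σ`
to be a nonnegative power of q times `T (nuMat n K * σ)`. Hence left multiplication by the
generators preserves the ℤ-span.

Conversely every `T σ` is generated, by induction on corank and then on reach. If the last row of σ
vanishes, σ = ντ with τ of larger rank and `T σ` = N·`T τ`. If σ has a descent, `T σ` = `T s`·`T (s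
* σ)` with smaller reach. Otherwise σ is diagonal and invertible. With the product formulas in hand,
the relations reduce to matrix identities. -/

theorem transvection_mem {i j : Fin n} (h : i < j) (b : K) :
    transvection i j b ∈ unitriangular n K := by
  refine ⟨fun k => ?_, fun k l hkl => ?_⟩
  · rw [transvection, Matrix.add_apply, one_apply_eq, single_apply_of_ne, add_zero]
    rintro ⟨rfl, rfl⟩
    exact lt_irrefl _ h
  · rw [transvection, Matrix.add_apply, one_apply_ne hkl.ne', single_apply_of_ne, add_zero]
    rintro ⟨rfl, rfl⟩
    exact lt_asymm hkl h

/-- An adjacent transposition reverses the order of the single pair i < j, so the (i, j) entry is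
the only one that conjugation could carry below the diagonal. -/
theorem swap_mul_mul_swap_mem {i j : Fin n} (hij : i.val + 1 = j.val)
    {u : Matrix (Fin n) (Fin n) K} (hu : u ∈ unitriangular n K) (h0 : u i j = 0) :
    swap K i j * u * swap K i j ∈ unitriangular n K := by
  have e : ∀ k l, (swap K i j * u * swap K i j) k l = u (Equiv.swap i j k) (Equiv.swap i j l) := by
    intro k l
    rw [swap, mul_assoc, PEquiv.toMatrix_toPEquiv_mul, PEquiv.mul_toMatrix_toPEquiv]
    simp
  refine ⟨fun k => by rw [e, hu.1], fun k l hkl => ?_⟩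
  rw [e]
  rw [Fin.lt_def] at hkl
  simp only [Equiv.swap_apply_def]
  split_ifs with h1 h2 h3 h4 h5 h6 <;> subst_vars <;> first
    | exact h0
    | omega
    | exact hu.2 _ _ (by rw [Fin.lt_def]; omega)

variable [Fintype K]

theorem unipIdem_mul_single {u : Matrix (Fin n) (Fin n) K} (hu : u ∈ unitriangular n K) :
    unipIdem n K * MonoidAlgebra.single u 1 = unipIdem n K := by
  rw [unipIdem, smul_mul_assoc, setSum_mul_single (isUnit_of_mem hu) fun x hx => mul_mem hx hu]

theorem single_mul_unipIdem {u : Matrix (Fin n) (Fin n) K} (hu : u ∈ unitriangular n K) :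
    MonoidAlgebra.single u 1 * unipIdem n K = unipIdem n K := by
  rw [unipIdem, mul_smul_comm, single_mul_setSum (isUnit_of_mem hu) fun x hx => mul_mem hu hx]

/-- The element `ε x ε`. -/
def bi (x : Matrix (Fin n) (Fin n) K) : Ambient n K :=
  ⟨unipIdem n K * MonoidAlgebra.single x 1 * unipIdem n K, ⟨MonoidAlgebra.single x 1, rfl⟩⟩

theorem bi_val (x : Matrix (Fin n) (Fin n) K) :
    (bi x).1 = unipIdem n K * MonoidAlgebra.single x 1 * unipIdem n K := rfl

theorem smul_val (c : ℚ) (x : Ambient n K) : (c • x).1 = c • x.1 := rfl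

theorem mul_val (x y : Ambient n K) : (x * y).1 = x.1 * y.1 := rfl

theorem one_val : (1 : Ambient n K).1 = unipIdem n K := rfl

theorem sum_val {ι : Type*} (s : Finset ι) (f : ι → Ambient n K) :
    (∑ i ∈ s, f i).1 = ∑ i ∈ s, (f i).1 := by
  classical
  induction s using Finset.induction_on with
  | empty => rfl
  | insert i s hi h => rw [Finset.sum_insert hi, Finset.sum_insert hi, ← h]; rfl

theorem bi_one : bi (1 : Matrix (Fin n) (Fin n) K) = 1 := by
  apply Subtype.ext
  rw [bi_val, one_val, ← MonoidAlgebra.one_def, mul_one]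
  exact isIdempotentElem_unipIdem n K

theorem bi_left {u : Matrix (Fin n) (Fin n) K} (hu : u ∈ unitriangular n K)
    (x : Matrix (Fin n) (Fin n) K) : bi (u * x) = bi x := by
  apply Subtype.ext
  have h : (MonoidAlgebra.single (u * x) (1 : ℚ)) =
    MonoidAlgebra.single u 1 * MonoidAlgebra.single x 1 := by
    rw [MonoidAlgebra.single_mul_single, mul_one]
  rw [bi_val, bi_val, h, ← mul_assoc (unipIdem n K), unipIdem_mul_single hu]

theorem bi_right {u : Matrix (Fin n) (Fin n) K} (hu : u ∈ unitriangular n K)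
    (x : Matrix (Fin n) (Fin n) K) : bi (x * u) = bi x := by
  apply Subtype.ext
  have h : (MonoidAlgebra.single (x * u) (1 : ℚ)) =
    MonoidAlgebra.single x 1 * MonoidAlgebra.single u 1 := by
    rw [MonoidAlgebra.single_mul_single, mul_one]
  rw [bi_val, bi_val, h, ← mul_assoc (unipIdem n K), mul_assoc _ _ (unipIdem n K),
    single_mul_unipIdem hu]

/-- The two inner factors ε merge into one, which is the average over U. -/
theorem bi_mul_bi (x y : Matrix (Fin n) (Fin n) K) :
    bi x * bi y = (Nat.card (unitriangular n K) : ℚ)⁻¹ •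
      ∑ u ∈ (unitriangular n K : Set (Matrix (Fin n) (Fin n) K)).toFinite.toFinset,
        bi (x * u * y) := by
  apply Subtype.ext
  rw [mul_val, smul_val, sum_val]
  have h : ∀ u : Matrix (Fin n) (Fin n) K, (bi (x * u * y)).1 =
      (unipIdem n K * MonoidAlgebra.single x 1) * MonoidAlgebra.single u 1 *
        (MonoidAlgebra.single y 1 * unipIdem n K) := by
    intro u
    rw [bi_val, ← mul_one (1 : ℚ), ← MonoidAlgebra.single_mul_single,
      ← mul_one (1 : ℚ), ← MonoidAlgebra.single_mul_single]
    simp only [mul_assoc, mul_one]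
  simp only [h]
  rw [← Finset.sum_mul, ← Finset.mul_sum, ← smul_mul_assoc, ← mul_smul_comm, bi_val, bi_val]
  have e : unipIdem n K = (Nat.card (unitriangular n K) : ℚ)⁻¹ •
      ∑ u ∈ (unitriangular n K : Set (Matrix (Fin n) (Fin n) K)).toFinite.toFinset,
        MonoidAlgebra.single u 1 := rfl
  rw [← e]
  simp only [mul_assoc]
  rw [← mul_assoc (unipIdem n K) (unipIdem n K), isIdempotentElem_unipIdem n K]

theorem average_const {x : Ambient n K} {f : Matrix (Fin n) (Fin n) K → Ambient n K}
    (h : ∀ u ∈ unitriangular n K, f u = x) :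
    (Nat.card (unitriangular n K) : ℚ)⁻¹ •
      ∑ u ∈ (unitriangular n K : Set (Matrix (Fin n) (Fin n) K)).toFinite.toFinset, f u = x := by
  rw [Finset.sum_congr rfl (g := fun _ => x) fun u hu => h u (by simpa using hu),
    Finset.sum_const, card_toFinset, ← Nat.cast_smul_eq_nsmul ℚ, inv_smul_smul₀ card_ne_zero]

theorem bi_mul_bi_of_left {x : Matrix (Fin n) (Fin n) K}
    (h : ∀ u ∈ unitriangular n K, ∃ v ∈ unitriangular n K, x * u = v * x)
    (y : Matrix (Fin n) (Fin n) K) : bi x * bi y = bi (x * y) := by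
  rw [bi_mul_bi]
  refine average_const fun u hu => ?_
  obtain ⟨v, hv, e⟩ := h u hu
  rw [e, mul_assoc, bi_left hv]

theorem bi_mul_bi_of_right {y : Matrix (Fin n) (Fin n) K}
    (h : ∀ u ∈ unitriangular n K, ∃ v ∈ unitriangular n K, u * y = y * v)
    (x : Matrix (Fin n) (Fin n) K) : bi x * bi y = bi (x * y) := by
  rw [bi_mul_bi]
  refine average_const fun u hu => ?_
  obtain ⟨v, hv, e⟩ := h u hu
  rw [mul_assoc, e, ← mul_assoc, bi_right hv]

/-- Right multiplication by a transvection permutes the unitriangular group. -/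
theorem sum_unitriangular_transvection {i j : Fin n} (h : i < j) (b : K)
    (f : Matrix (Fin n) (Fin n) K → Ambient n K) :
    ∑ u ∈ (unitriangular n K : Set (Matrix (Fin n) (Fin n) K)).toFinite.toFinset,
        f (u * transvection i j b) =
      ∑ u ∈ (unitriangular n K : Set (Matrix (Fin n) (Fin n) K)).toFinite.toFinset, f u := by
  refine Finset.sum_nbij' (fun u => u * transvection i j b) (fun u => u * transvection i j (-b))
    ?_ ?_ ?_ ?_ fun _ _ => rfl
  · intro u hu
    simp only [Set.Finite.mem_toFinset, SetLike.mem_coe] at hu ⊢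
    exact mul_mem hu (transvection_mem h b)
  · intro u hu
    simp only [Set.Finite.mem_toFinset, SetLike.mem_coe] at hu ⊢
    exact mul_mem hu (transvection_mem h _)
  · intro u _
    simp [mul_assoc, transvection_mul_transvection_same, h.ne]
  · intro u _
    simp [mul_assoc, transvection_mul_transvection_same, h.ne]

theorem card_field_ne_zero : (Fintype.card K : ℚ) ≠ 0 := Nat.cast_ne_zero.2 Fintype.card_ne_zero

/-- Each u in U factors as u' times a transvection with parameter u i j, where u' has (i, j) entry
0. The conjugate of u' by the transposition stays in U and is absorbed by ε on the left. -/
theorem bi_swap_mul_bi {i j : Fin n} (hij : i.val + 1 = j.val)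
    (y : Matrix (Fin n) (Fin n) K) :
    bi (swap K i j) * bi y =
      (Fintype.card K : ℚ)⁻¹ • ∑ b : K, bi (swap K i j * (transvection i j b * y)) := by
  have hlt : i < j := by rw [Fin.lt_def]; omega
  have h1 : ∀ u ∈ unitriangular n K,
      bi (swap K i j * u * y) = bi (swap K i j * (transvection i j (u i j) * y)) := by
    intro u hu
    have hu' := swap_mul_mul_swap_mem hij (mul_mem hu (transvection_mem hlt (-u i j)))
      (by rw [mul_transvection_apply_same, hu.1]; ring)
    have e : swap K i j * u * y = (swap K i j * (u * transvection i j (-u i j)) * swap K i j) *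
        (swap K i j * (transvection i j (u i j) * y)) := by
      simp only [mul_assoc]
      rw [← mul_assoc (swap K i j) (swap K i j), swap_mul_self, one_mul,
        ← mul_assoc (transvection i j (-u i j)),
        transvection_mul_transvection_same _ _ hlt.ne, neg_add_cancel, transvection_zero, one_mul]
    rw [e, bi_left hu']
  -- Translating U by a transvection shifts the parameter u i j by any b. After summation over b the
  -- inner sum no longer depends on u, so the fibres of u ↦ u i j need not be counted.
  have h2 : ∀ b : K, bi (swap K i j) * bi y = (Nat.card (unitriangular n K) : ℚ)⁻¹ •
      ∑ u ∈ (unitriangular n K : Set (Matrix (Fin n) (Fin n) K)).toFinite.toFinset,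
        bi (swap K i j * (transvection i j (u i j + b) * y)) := by
    intro b
    rw [bi_mul_bi, ← sum_unitriangular_transvection hlt b]
    congr 1
    refine Finset.sum_congr rfl fun u hu => ?_
    have hu : u ∈ unitriangular n K := by simpa using hu
    rw [h1 _ (mul_mem hu (transvection_mem hlt b)), mul_transvection_apply_same, hu.1, mul_one]
  have h3 : (Fintype.card K : ℚ) • (bi (swap K i j) * bi y) =
      ∑ b : K, bi (swap K i j * (transvection i j b * y)) := by
    rw [← Finset.card_univ, Nat.cast_smul_eq_nsmul, ← Finset.sum_const,
      Finset.sum_congr rfl fun b _ => h2 b, ← Finset.smul_sum, Finset.sum_comm]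
    refine average_const fun u hu => ?_
    exact Equiv.sum_comp (Equiv.addLeft (u i j)) fun b => bi (swap K i j * (transvection i j b * y))
  rw [← h3, inv_smul_smul₀ card_field_ne_zero]

/-- The sum over the double class is fixed by ε on both sides, and each of its terms becomes εσε
between two factors ε. -/
theorem setSum_doubleClass (σ : Matrix (Fin n) (Fin n) K) :
    setSum (doubleClass σ) = (Nat.card (doubleClass σ) : ℚ) • (bi σ).1 := by
  have h1 : unipIdem n K * setSum (doubleClass σ) * unipIdem n K = setSum (doubleClass σ) := by
    rw [unipIdem_mul_setSum, setSum_mul_unipIdem]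
    · rintro w hw _ ⟨u, hu, v, hv, rfl⟩
      exact ⟨u, hu, v * w, mul_mem hv hw, by simp only [mul_assoc]⟩
    · rintro w hw _ ⟨u, hu, v, hv, rfl⟩
      exact ⟨w * u, mul_mem hw hu, v, hv, by simp only [mul_assoc]⟩
  rw [← h1, setSum, Finset.mul_sum, Finset.sum_mul,
    Finset.sum_congr rfl (g := fun _ => (bi σ).1), Finset.sum_const, Nat.cast_smul_eq_nsmul,
    Nat.card_eq_card_finite_toFinset (Set.toFinite _)]
  intro x hx
  obtain ⟨u, hu, v, hv, rfl⟩ : x ∈ doubleClass σ := by simpa using hx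
  rw [← bi_val, bi_right hv, bi_left hu]

/-- The factor by which `T_σ` differs from `ε σ ε`. -/
def scal (σ : Matrix (Fin n) (Fin n) K) : ℚ :=
  ((Fintype.card K : ℚ) ^ (σ.rank * (σ.rank - 1) / 2))⁻¹ * Nat.card (doubleClass σ)

theorem T_eq (σ : Matrix (Fin n) (Fin n) K) : T σ = scal σ • bi σ := by
  apply Subtype.ext
  rw [smul_val, scal, mul_smul, ← setSum_doubleClass]
  rfl

end

/-! ### The size of a double class -/

section

variable {n : ℕ} {K : Type*} [Field K]

open Classical in
/-- The positions strictly above or strictly to the right of a nonzero entry of `σ`. -/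
def reach (σ : Matrix (Fin n) (Fin n) K) : Finset (Fin n × Fin n) :=
  Finset.univ.filter fun p => (∃ k, p.1 < k ∧ σ k p.2 ≠ 0) ∨ ∃ l, l < p.2 ∧ σ p.1 l ≠ 0

theorem mem_reach {σ : Matrix (Fin n) (Fin n) K} {i j : Fin n} :
    (i, j) ∈ reach σ ↔ (∃ k, i < k ∧ σ k j ≠ 0) ∨ ∃ l, l < j ∧ σ i l ≠ 0 := by
  simp [reach]

/-- The strictly upper triangular matrices. -/
def strictUpper (n : ℕ) (K : Type*) [Field K] : Submodule K (Matrix (Fin n) (Fin n) K) where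
  carrier := {A | ∀ i j, j ≤ i → A i j = 0}
  zero_mem' := fun _ _ _ => rfl
  add_mem' := fun hA hB i j h => by simp [hA i j h, hB i j h]
  smul_mem' := fun c A hA i j h => by simp [hA i j h]

theorem sub_one_mem_strictUpper {u : Matrix (Fin n) (Fin n) K} (hu : u ∈ unitriangular n K) :
    u - 1 ∈ strictUpper n K := by
  intro i j h
  rcases h.lt_or_eq with h | rfl
  · simp [hu.2 i j h, h.ne']
  · simp [hu.1]

theorem add_one_mem_unitriangular {m : Matrix (Fin n) (Fin n) K} (hm : m ∈ strictUpper n K) :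
    m + 1 ∈ unitriangular n K :=
  ⟨fun i => by simp [hm i i le_rfl], fun i j h => by simp [hm i j h.le, h.ne']⟩

/-- Subtracting the identity matrix. -/
def unitriangularEquiv (n : ℕ) (K : Type*) [Field K] : unitriangular n K ≃ strictUpper n K where
  toFun u := ⟨u.1 - 1, sub_one_mem_strictUpper u.2⟩
  invFun m := ⟨m.1 + 1, add_one_mem_unitriangular m.2⟩
  left_inv u := by simp
  right_inv m := by simp

/-- The map `(m, m') ↦ m σ - σ m'` on strictly upper triangular matrices. -/
def tangentMap (σ : Matrix (Fin n) (Fin n) K) :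
    (strictUpper n K × strictUpper n K) →ₗ[K] Matrix (Fin n) (Fin n) K :=
  LinearMap.coprod ((LinearMap.mulRight K σ).comp (strictUpper n K).subtype)
    (-(LinearMap.mulLeft K σ).comp (strictUpper n K).subtype)

theorem tangentMap_apply (σ : Matrix (Fin n) (Fin n) K) (m m' : strictUpper n K) :
    tangentMap σ (m, m') = m.1 * σ - σ * m'.1 := by
  simp [tangentMap, sub_eq_add_neg]

/-- A nonzero entry of σ is alone in its row and column. So E_{i,k}σ is a nonzero multiple of
E_{i,j} when σ k j ≠ 0, and σE_{l,j} is one when σ i l ≠ 0. With i < k, respectively l < j, these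
give exactly the positions of the reach. -/
theorem mem_range_tangentMap {σ : Matrix (Fin n) (Fin n) K} (hσ : σ ∈ rookMonoid n K)
    (x : Matrix (Fin n) (Fin n) K) :
    x ∈ LinearMap.range (tangentMap σ) ↔ ∀ i j, (i, j) ∉ reach σ → x i j = 0 := by
  constructor
  · rintro ⟨⟨m, m'⟩, rfl⟩ i j h
    rw [mem_reach] at h
    push Not at h
    rw [tangentMap_apply, Matrix.sub_apply, mul_apply, mul_apply, Finset.sum_eq_zero,
      Finset.sum_eq_zero, sub_zero]
    · intro l _
      rcases lt_or_ge l j with hl | hl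
      · rw [h.2 l hl, zero_mul]
      · rw [m'.2 l j hl, mul_zero]
    · intro k _
      rcases lt_or_ge i k with hk | hk
      · rw [h.1 k hk, mul_zero]
      · rw [m.2 i k hk, zero_mul]
  · intro h
    have hs : ∀ {i j : Fin n} (_ : i < j) (c : K), single i j c ∈ strictUpper n K := by
      intro i j hij c k l hkl
      refine single_apply_of_ne _ _ _ _ _ ?_
      rintro ⟨rfl, rfl⟩
      exact absurd hij hkl.not_gt
    rw [matrix_eq_sum_single x]
    refine Submodule.sum_mem _ fun i _ => Submodule.sum_mem _ fun j _ => ?_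
    by_cases hij : (i, j) ∈ reach σ
    · rcases mem_reach.1 hij with ⟨k, hk, hk'⟩ | ⟨l, hl, hl'⟩
      · refine ⟨(⟨single i k (x i j / σ k j), hs hk _⟩, 0), ?_⟩
        rw [tangentMap_apply, Submodule.coe_zero, mul_zero, sub_zero]
        ext a b
        rcases eq_or_ne a i with rfl | ha
        · rw [single_mul_apply_same]
          rcases eq_or_ne b j with rfl | hb
          · rw [single_apply_same, div_mul_cancel₀ _ hk']
          · rw [single_apply_of_ne _ _ _ _ _ (fun e => hb e.2.symm)]
            by_contra h0
            exact hb (hσ.1 k b j (right_ne_zero_of_mul h0) hk')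
        · rw [single_mul_apply_of_ne _ _ _ _ _ ha,
            single_apply_of_ne _ _ _ _ _ (fun e => ha e.1.symm)]
      · refine ⟨(0, ⟨single l j (-(x i j) / σ i l), hs hl _⟩), ?_⟩
        rw [tangentMap_apply, Submodule.coe_zero, zero_mul, zero_sub]
        ext a b
        rw [Matrix.neg_apply]
        rcases eq_or_ne b j with rfl | hb
        · rw [mul_single_apply_same]
          rcases eq_or_ne a i with rfl | ha
          · rw [single_apply_same, mul_div_cancel₀ _ hl', neg_neg]
          · rw [single_apply_of_ne _ _ _ _ _ (fun e => ha e.1.symm), neg_eq_zero]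
            by_contra h0
            exact ha (hσ.2 a i l (left_ne_zero_of_mul h0) hl')
        · rw [mul_single_apply_of_ne _ _ _ _ _ hb,
            single_apply_of_ne _ _ _ _ _ (fun e => hb e.2.symm), neg_zero]
    · rw [h i j hij, single_zero]
      exact zero_mem _

variable [Fintype K]

theorem card_range_tangentMap {σ : Matrix (Fin n) (Fin n) K} (hσ : σ ∈ rookMonoid n K) :
    Nat.card (LinearMap.range (tangentMap σ)) = Fintype.card K ^ (reach σ).card := by
  classical
  let e : LinearMap.range (tangentMap σ) ≃ (reach σ → K) :=
    { toFun := fun x p => x.1 p.1.1 p.1.2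
      invFun := fun f => ⟨of fun i j => if h : (i, j) ∈ reach σ then f ⟨(i, j), h⟩ else 0,
        (mem_range_tangentMap hσ _).2 fun i j h => by simp [h]⟩
      left_inv := by
        intro x
        ext i j
        by_cases h : (i, j) ∈ reach σ
        · simp [h]
        · simp [h, (mem_range_tangentMap hσ _).1 x.2 i j h]
      right_inv := by
        intro f
        ext p
        simp }
  rw [Nat.card_congr e, Nat.card_fun, Nat.card_eq_fintype_card, Nat.card_eq_fintype_card,
    Fintype.card_coe]

/-- The finite monoid of upper unitriangular matrices is a group. -/
instance unitriangularGroup : Group (unitriangular n K) :=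
  groupOfIsUnit fun u => by
    have hi : Function.Injective fun v : unitriangular n K => u * v := fun v w h =>
      Subtype.ext ((isUnit_of_mem u.2).mul_left_cancel (congrArg Subtype.val h))
    obtain ⟨v, hv⟩ := Finite.surjective_of_injective hi 1
    exact ⟨⟨u, v, hv, hi (by
      change u * (v * u) = u * 1
      rw [← mul_assoc, show u * v = 1 from hv, one_mul, mul_one])⟩, rfl⟩

/-- The action of `U × U` on matrices whose orbits are the double classes. -/
instance doubleAction :
    MulAction (unitriangular n K × unitriangular n K) (Matrix (Fin n) (Fin n) K) where
  smul g x := g.1.1 * x * (g.2⁻¹).1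
  one_smul x := by
    change (1 : Matrix _ _ K) * x * ((1 : unitriangular n K)⁻¹).1 = x
    rw [inv_one, Submonoid.coe_one, one_mul, mul_one]
  mul_smul g h x := by
    change (g.1.1 * h.1.1) * x * ((g.2 * h.2)⁻¹).1 = g.1.1 * (h.1.1 * x * (h.2⁻¹).1) * (g.2⁻¹).1
    rw [_root_.mul_inv_rev, Submonoid.coe_mul]
    simp only [mul_assoc]

theorem orbit_eq_doubleClass (σ : Matrix (Fin n) (Fin n) K) :
    MulAction.orbit (unitriangular n K × unitriangular n K) σ = doubleClass σ := by
  ext x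
  constructor
  · rintro ⟨g, rfl⟩
    exact ⟨g.1.1, g.1.2, (g.2⁻¹).1, (g.2⁻¹).2, rfl⟩
  · rintro ⟨u, hu, v, hv, rfl⟩
    refine ⟨(⟨u, hu⟩, ⟨v, hv⟩⁻¹), ?_⟩
    change u * σ * ((⟨v, hv⟩ : unitriangular n K)⁻¹⁻¹).1 = _
    rw [inv_inv]

/-- The stabilizer of `σ` has the size of the kernel of `tangentMap σ`. -/
theorem card_stabilizer (σ : Matrix (Fin n) (Fin n) K) :
    Nat.card (MulAction.stabilizer (unitriangular n K × unitriangular n K) σ) =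
      Nat.card (LinearMap.ker (tangentMap σ)) := by
  refine Nat.card_congr (Equiv.subtypeEquiv
    (Equiv.prodCongr (unitriangularEquiv n K) (unitriangularEquiv n K)) ?_)
  rintro ⟨u, v⟩
  rw [LinearMap.mem_ker, MulAction.mem_stabilizer_iff]
  change u.1 * σ * (v⁻¹).1 = σ ↔ tangentMap σ (unitriangularEquiv n K u, unitriangularEquiv n K v) = 0
  rw [tangentMap_apply, sub_eq_zero]
  change _ ↔ (u.1 - 1) * σ = σ * (v.1 - 1)
  -- With u = 1 + m and v = 1 + m', the common term σ cancels from uσ = σv, and a linear condition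
  -- on (m, m') remains.
  rw [sub_mul, mul_sub, one_mul, mul_one, sub_left_inj]
  have h1 : v.1 * (v⁻¹).1 = 1 := congrArg Subtype.val (mul_inv_cancel v)
  have h2 : (v⁻¹).1 * v.1 = 1 := congrArg Subtype.val (inv_mul_cancel v)
  constructor
  · intro h
    conv_rhs => rw [← h, mul_assoc, h2, mul_one]
  · intro h
    rw [h, mul_assoc, h1, mul_one]

/-- U × U and the domain of `tangentMap σ` have equal size, and so do the stabilizer and the kernel.
Orbit-stabilizer and rank-nullity then give the orbit the size of the range. -/
theorem card_doubleClass {σ : Matrix (Fin n) (Fin n) K} (hσ : σ ∈ rookMonoid n K) :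
    Nat.card (doubleClass σ) = Fintype.card K ^ (reach σ).card := by
  have h1 := Nat.card_congr
    (MulAction.orbitProdStabilizerEquivGroup (unitriangular n K × unitriangular n K) σ)
  rw [Nat.card_prod, orbit_eq_doubleClass, card_stabilizer] at h1
  have h2 := Nat.card_congr
    (Equiv.prodCongr (unitriangularEquiv n K) (unitriangularEquiv n K))
  have h3 := Submodule.card_eq_card_quotient_mul_card (LinearMap.ker (tangentMap σ))
  rw [Nat.card_congr (tangentMap σ).quotKerEquivRange.toEquiv, card_range_tangentMap hσ] at h3
  rw [h2, h3, mul_comm] at h1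
  exact Nat.eq_of_mul_eq_mul_right Nat.card_pos (by rw [mul_comm, h1, mul_comm])

end

/-! ### Rank and reach under multiplication by transpositions and by ν -/

section

variable {n : ℕ} {K : Type*} [Field K]

open Classical in
/-- The indices of the nonzero columns. -/
def nonzeroCols (σ : Matrix (Fin n) (Fin n) K) : Finset (Fin n) :=
  Finset.univ.filter fun j => ∃ i, σ i j ≠ 0

theorem mem_nonzeroCols {σ : Matrix (Fin n) (Fin n) K} {j : Fin n} :
    j ∈ nonzeroCols σ ↔ ∃ i, σ i j ≠ 0 := by
  simp [nonzeroCols]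

theorem transpose_mem_rookMonoid {σ : Matrix (Fin n) (Fin n) K} (hσ : σ ∈ rookMonoid n K) :
    σᵀ ∈ rookMonoid n K :=
  ⟨fun i j j' => hσ.2 j j' i, fun i i' j => hσ.1 j i i'⟩

/-- The upper bound factors σ through a 0-1 diagonal matrix. The lower bound uses that σᵀσ is
diagonal: each diagonal entry is a sum with at most one nonzero square, so nothing can cancel over
K. -/
theorem rank_eq_card_nonzeroCols {σ : Matrix (Fin n) (Fin n) K} (hσ : σ ∈ rookMonoid n K) :
    σ.rank = (nonzeroCols σ).card := by
  classical
  have key : ∀ w : Fin n → K, (∀ j, w j ≠ 0 ↔ ∃ i, σ i j ≠ 0) →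
      (diagonal w).rank = (nonzeroCols σ).card := by
    intro w hw
    rw [rank_diagonal, Fintype.card_subtype, nonzeroCols]
    congr 1
    ext j
    simp [hw j]
  apply le_antisymm
  · have e : σ = σ * diagonal fun j => if ∃ i, σ i j ≠ 0 then 1 else 0 := by
      ext i j
      rw [mul_diagonal]
      split_ifs with h
      · rw [mul_one]
      · push Not at h
        rw [h i, zero_mul]
    rw [e]
    refine (rank_mul_le_right _ _).trans_eq ?_
    rw [← e]
    exact key _ fun j => by split_ifs with h <;> simpa using h
  · have e : σᵀ * σ = diagonal fun j => ∑ i, σ i j * σ i j := by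
      ext j l
      rw [mul_apply, diagonal_apply]
      split_ifs with h
      · subst h
        rfl
      · refine Finset.sum_eq_zero fun i _ => ?_
        by_contra h0
        exact h (hσ.1 i j l (left_ne_zero_of_mul h0) (right_ne_zero_of_mul h0))
    rw [← key (fun j => ∑ i, σ i j * σ i j), ← e]
    · exact rank_mul_le_right _ _
    · intro j
      constructor
      · intro h
        obtain ⟨i, -, hi⟩ := Finset.exists_ne_zero_of_sum_ne_zero h
        exact ⟨i, left_ne_zero_of_mul hi⟩
      · rintro ⟨i, hi⟩
        rw [Finset.sum_eq_single i]
        · exact mul_ne_zero hi hi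
        · intro k _ hk
          by_contra h0
          exact hk (hσ.2 k i j (left_ne_zero_of_mul h0) hi)
        · simp

theorem exists_zero_col {σ : Matrix (Fin n) (Fin n) K} (hσ : σ ∈ rookMonoid n K) {i : Fin n}
    (hi : ∀ j, σ i j = 0) : ∃ j, ∀ k, σ k j = 0 := by
  have h1 := rank_eq_card_nonzeroCols (transpose_mem_rookMonoid hσ)
  rw [rank_transpose, rank_eq_card_nonzeroCols hσ] at h1
  have h2 : (nonzeroCols σᵀ).card < n := by
    conv_rhs => rw [← Fintype.card_fin n]
    refine Finset.card_lt_univ_of_notMem (x := i) ?_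
    rw [mem_nonzeroCols]
    simp [hi]
  by_contra h
  push Not at h
  have h3 : nonzeroCols σ = Finset.univ := by
    ext j
    simpa [mem_nonzeroCols] using h j
  rw [← h1, h3, Finset.card_univ, Fintype.card_fin] at h2
  exact lt_irrefl _ h2

theorem reach_congr {σ τ : Matrix (Fin n) (Fin n) K} (h : ∀ i j, σ i j ≠ 0 ↔ τ i j ≠ 0) :
    reach σ = reach τ := by
  ext ⟨i, j⟩
  simp only [mem_reach, h]

theorem nonzeroCols_congr {σ τ : Matrix (Fin n) (Fin n) K} (h : ∀ i j, σ i j ≠ 0 ↔ τ i j ≠ 0) :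
    nonzeroCols σ = nonzeroCols τ := by
  ext j
  simp only [mem_nonzeroCols, h]

theorem card_reach_one : (reach (1 : Matrix (Fin n) (Fin n) K)).card = n * (n - 1) / 2 := by
  classical
  have h : reach (1 : Matrix (Fin n) (Fin n) K) =
      (Finset.univ.sigma (fun j : Fin n => Finset.Iio j)).map
        ⟨fun p => (p.2, p.1), fun p q h => by
          obtain ⟨a, b⟩ := p
          obtain ⟨c, d⟩ := q
          simp only [Prod.mk.injEq] at h
          obtain ⟨rfl, rfl⟩ := h
          rfl⟩ := by
    ext ⟨i, j⟩
    simp only [mem_reach, one_apply, Finset.mem_map, Finset.mem_sigma, Finset.mem_univ, true_and,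
      Finset.mem_Iio, Sigma.exists]
    constructor
    · rintro (⟨k, hk, h⟩ | ⟨k, hk, h⟩)
      · obtain rfl : k = j := by simpa using h
        exact ⟨_, _, hk, rfl⟩
      · obtain rfl : i = k := by simpa using h
        exact ⟨_, _, hk, rfl⟩
    · rintro ⟨a, b, hab, h⟩
      obtain ⟨rfl, rfl⟩ := Prod.mk.inj h
      exact Or.inl ⟨a, hab, by simp⟩
  rw [h, Finset.card_map, Finset.card_sigma, ← Finset.sum_range_id]
  simp only [Fin.card_Iio]
  exact Fin.sum_univ_eq_sum_range (fun i => i) n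

theorem swap_mul_apply {i j : Fin n} (σ : Matrix (Fin n) (Fin n) K) (k l : Fin n) :
    (swap K i j * σ) k l = σ (Equiv.swap i j k) l := by
  rw [swap, PEquiv.toMatrix_toPEquiv_mul]
  rfl

theorem swap_mem_rookMonoid (i j : Fin n) : swap K i j ∈ rookMonoid n K := by
  have e : ∀ k l, swap K i j k l ≠ 0 → Equiv.swap i j k = l := by
    intro k l h
    rw [← mul_one (swap K i j), swap_mul_apply, one_apply] at h
    by_contra h0
    exact h (if_neg h0)
  refine ⟨fun k l l' h h' => (e _ _ h).symm.trans (e _ _ h'), fun k k' l h h' => ?_⟩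
  exact (Equiv.swap i j).injective ((e _ _ h).trans (e _ _ h').symm)

/-- This is the rule that length grows by one at an ascent. Exchanging the two rows carries the old
reach into the new one. The only additional position is (i, p), now above the entry moved to (j, p);
it would come from (j, p), which was not in the reach of σ. -/
theorem card_reach_swap_mul {i j : Fin n} (hij : i.val + 1 = j.val)
    {σ : Matrix (Fin n) (Fin n) K} (hσ : σ ∈ rookMonoid n K) {p : Fin n} (hp : σ i p ≠ 0)
    (hc : ∀ l, σ j l ≠ 0 → p < l) :
    (reach (swap K i j * σ)).card = (reach σ).card + 1 := by
  classical
  have hinj : Function.Injective fun x : Fin n × Fin n => (Equiv.swap i j x.1, x.2) := by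
    rintro ⟨a, b⟩ ⟨c, d⟩ h
    simpa using h
  have hsw : ∀ k, Equiv.swap i j (Equiv.swap i j k) = k := Equiv.swap_apply_self i j
  have h : reach (swap K i j * σ) =
      insert (i, p) ((reach σ).image fun x => (Equiv.swap i j x.1, x.2)) := by
    ext ⟨k, l⟩
    have e : (k, l) ∈ (reach σ).image (fun x => (Equiv.swap i j x.1, x.2)) ↔
        (Equiv.swap i j k, l) ∈ reach σ := by
      rw [Finset.mem_image]
      constructor
      · rintro ⟨⟨a, b⟩, hab, h⟩
        obtain ⟨rfl, rfl⟩ := Prod.mk.inj h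
        rwa [hsw]
      · intro h
        exact ⟨_, h, by simp⟩
    rw [Finset.mem_insert, e, mem_reach, mem_reach]
    simp only [swap_mul_apply]
    rcases eq_or_ne k i with rfl | hki
    · rw [Equiv.swap_apply_left]
      constructor
      · rintro (⟨m, hm, hm'⟩ | h)
        · rcases eq_or_ne m j with rfl | hmj
          · rw [Equiv.swap_apply_right] at hm'
            exact Or.inl (Prod.ext rfl (hσ.1 _ _ _ hm' hp))
          · rw [Equiv.swap_apply_of_ne_of_ne hm.ne' hmj] at hm'
            refine Or.inr (Or.inl ⟨m, ?_, hm'⟩)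
            rw [Fin.lt_def] at hm ⊢
            have := Fin.val_ne_iff.2 hmj
            omega
        · exact Or.inr (Or.inr h)
      · rintro (h | ⟨m, hm, hm'⟩ | h)
        · obtain rfl : l = p := (Prod.mk.inj h).2
          exact Or.inl ⟨j, by rw [Fin.lt_def]; omega, by rwa [Equiv.swap_apply_right]⟩
        · have hkm : k < m := by rw [Fin.lt_def] at hm ⊢; omega
          exact Or.inl ⟨m, hkm, by rwa [Equiv.swap_apply_of_ne_of_ne hkm.ne' hm.ne']⟩
        · exact Or.inr h
    have hne : (k, l) ≠ (i, p) := fun h => hki (Prod.mk.inj h).1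
    simp only [hne, false_or]
    rcases eq_or_ne k j with rfl | hkj
    · rw [Equiv.swap_apply_right]
      have hik : i < k := by rw [Fin.lt_def]; omega
      constructor
      · rintro (⟨m, hm, hm'⟩ | h)
        · rw [Equiv.swap_apply_of_ne_of_ne (hik.trans hm).ne' hm.ne'] at hm'
          exact Or.inl ⟨m, hik.trans hm, hm'⟩
        · exact Or.inr h
      · rintro (⟨m, hm, hm'⟩ | h)
        · rcases eq_or_ne m k with rfl | hmk
          · exact Or.inr ⟨p, hc l hm', hp⟩
          · refine Or.inl ⟨m, ?_, by rwa [Equiv.swap_apply_of_ne_of_ne hm.ne' hmk]⟩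
            rw [Fin.lt_def] at hm ⊢
            have := Fin.val_ne_iff.2 hmk
            omega
        · exact Or.inr h
    · rw [Equiv.swap_apply_of_ne_of_ne hki hkj]
      have hlt : ∀ m, k < m → k < Equiv.swap i j m := by
        intro m hm
        have h1 := Fin.val_ne_iff.2 hki
        have h2 := Fin.val_ne_iff.2 hkj
        rw [Fin.lt_def] at hm ⊢
        rw [Equiv.swap_apply_def]
        split_ifs with h3 h4 <;> subst_vars <;> omega
      refine or_congr ⟨?_, ?_⟩ Iff.rfl
      · rintro ⟨m, hm, hm'⟩
        exact ⟨_, hlt m hm, hm'⟩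
      · rintro ⟨m, hm, hm'⟩
        exact ⟨_, hlt m hm, by rwa [hsw]⟩
  rw [h, Finset.card_insert_of_notMem, Finset.card_image_of_injective _ hinj]
  rw [Finset.mem_image]
  rintro ⟨⟨a, b⟩, hab, h⟩
  obtain ⟨h1, rfl⟩ := Prod.mk.inj h
  obtain rfl : a = j := by rw [← hsw a, h1, Equiv.swap_apply_left]
  rcases mem_reach.1 hab with ⟨m, hm, hm'⟩ | ⟨l, hl, hl'⟩
  · obtain rfl := hσ.2 _ _ _ hm' hp
    rw [Fin.lt_def] at hm
    omega
  · exact lt_asymm hl (hc l hl')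

theorem rank_swap_mul (i j : Fin n) (σ : Matrix (Fin n) (Fin n) K) :
    (swap K i j * σ).rank = σ.rank := by
  refine rank_mul_eq_right_of_isUnit_det _ _ ?_
  refine (isUnit_iff_isUnit_det _).1 ?_
  exact ⟨⟨_, _, swap_mul_self i j, swap_mul_self i j⟩, rfl⟩

theorem nuMat_mul_apply (σ : Matrix (Fin n) (Fin n) K) (i j : Fin n) :
    (nuMat n K * σ) i j = if h : i.val + 1 < n then σ ⟨i.val + 1, h⟩ j else 0 := by
  rw [mul_apply]
  split_ifs with h
  · rw [Finset.sum_eq_single ⟨i.val + 1, h⟩]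
    · simp [nuMat]
    · intro k _ hk
      have := Fin.val_ne_iff.2 hk
      simp only at this
      rw [nuMat, of_apply, if_neg (by omega), zero_mul]
    · simp
  · refine Finset.sum_eq_zero fun k _ => ?_
    rw [nuMat, of_apply, if_neg (by have := k.2; omega), zero_mul]

theorem nuMat_mem_rookMonoid : nuMat n K ∈ rookMonoid n K := by
  refine ⟨fun i j j' h h' => ?_, fun i i' j h h' => ?_⟩ <;>
  · simp only [nuMat, of_apply, ne_eq, ite_eq_right_iff, one_ne_zero, imp_false, not_not] at h h'
    apply Fin.ext
    omega

theorem nuMat_mul_ne_zero_iff {σ : Matrix (Fin n) (Fin n) K} {i j : Fin n} :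
    (nuMat n K * σ) i j ≠ 0 ↔ ∃ k : Fin n, i.val + 1 = k.val ∧ σ k j ≠ 0 := by
  rw [nuMat_mul_apply]
  split_ifs with h
  · constructor
    · exact fun h' => ⟨_, rfl, h'⟩
    · rintro ⟨k, hk, hk'⟩
      have : k = ⟨i.val + 1, h⟩ := Fin.ext hk.symm
      rwa [this] at hk'
  · simp only [ne_eq, not_true, false_iff, not_exists, not_and]
    intro k hk
    exact absurd (hk ▸ k.2) h

theorem mem_reach_nuMat_mul {σ : Matrix (Fin n) (Fin n) K} {k l : Fin n}
    (hk : k.val ≠ 0) :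
    (⟨k.val - 1, by omega⟩, l) ∈ reach (nuMat n K * σ) ↔ (k, l) ∈ reach σ := by
  simp only [mem_reach, nuMat_mul_ne_zero_iff, Fin.lt_def]
  refine or_congr ⟨?_, ?_⟩ (exists_congr fun m => and_congr_right fun _ => ⟨?_, ?_⟩)
  · rintro ⟨m, hm, m', hm', h⟩
    exact ⟨m', by omega, h⟩
  · rintro ⟨m, hm, h⟩
    exact ⟨⟨m.val - 1, by omega⟩, by simp only; omega, m, by simp only; omega, h⟩
  · rintro ⟨m', hm', h⟩
    obtain rfl : m' = k := Fin.ext (by omega)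
    exact h
  · exact fun h => ⟨k, by omega, h⟩

/-- Multiplication by ν drops the first row and shifts the others up, and the reach follows: what is
lost is its first row. -/
theorem card_reach_nuMat_mul (hn : 0 < n) (σ : Matrix (Fin n) (Fin n) K) :
    (reach σ).card = (reach (nuMat n K * σ)).card +
      (Finset.univ.filter fun j => ((⟨0, hn⟩ : Fin n), j) ∈ reach σ).card := by
  classical
  rw [← Finset.card_filter_add_card_filter_not (fun x : Fin n × Fin n => x.1.val ≠ 0)]
  congr 1
  · refine Finset.card_bij (fun x _ => (⟨x.1.val - 1, by omega⟩, x.2)) ?_ ?_ ?_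
    · rintro ⟨k, l⟩ h
      rw [Finset.mem_filter] at h
      exact (mem_reach_nuMat_mul h.2).2 h.1
    · rintro ⟨k, l⟩ h ⟨k', l'⟩ h' e
      rw [Finset.mem_filter] at h h'
      have h := h.2
      have h' := h'.2
      simp only [Prod.mk.injEq, Fin.ext_iff] at e h h' ⊢
      omega
    · rintro ⟨k, l⟩ h
      have hk : k.val + 1 < n := by
        rcases mem_reach.1 h with ⟨m, hm, h'⟩ | ⟨m, hm, h'⟩
        · rw [Fin.lt_def] at hm
          omega
        · obtain ⟨m', hm', -⟩ := nuMat_mul_ne_zero_iff.1 h'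
          omega
      refine ⟨(⟨k.val + 1, hk⟩, l), ?_, ?_⟩
      · rw [Finset.mem_filter]
        exact ⟨(mem_reach_nuMat_mul (by simp)).1 h, by simp⟩
      · simp
  · refine Finset.card_bij (fun x _ => x.2) ?_ ?_ ?_
    · rintro ⟨k, l⟩ h
      simp only [Finset.mem_filter, ne_eq, not_not, Finset.mem_univ, true_and] at h ⊢
      obtain rfl : k = ⟨0, hn⟩ := Fin.ext h.2
      exact h.1
    · rintro ⟨k, l⟩ h ⟨k', l'⟩ h' e
      simp only [Finset.mem_filter, ne_eq, not_not] at h h'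
      simp only [Prod.mk.injEq, Fin.ext_iff] at e ⊢
      omega
    · intro l h
      exact ⟨(⟨0, hn⟩, l), by simpa using h, rfl⟩

theorem exists_erase_subset (hn : 0 < n) {σ : Matrix (Fin n) (Fin n) K}
    (hσ : σ ∈ rookMonoid n K) : ∃ p, ∀ j ∈ (nonzeroCols σ).erase p, ∃ k, 0 < k.val ∧ σ k j ≠ 0 := by
  by_cases h : ∃ p, σ ⟨0, hn⟩ p ≠ 0
  · obtain ⟨p, hp⟩ := h
    refine ⟨p, fun j hj => ?_⟩
    rw [Finset.mem_erase, mem_nonzeroCols] at hj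
    obtain ⟨hj, k, hk⟩ := hj
    refine ⟨k, Nat.pos_of_ne_zero fun h0 => hj ?_, hk⟩
    obtain rfl : k = ⟨0, hn⟩ := Fin.ext h0
    exact hσ.1 _ _ _ hk hp
  · push Not at h
    -- If the first row is zero no column is lost, and the erased index is arbitrary.
    refine ⟨⟨0, hn⟩, fun j hj => ?_⟩
    rw [Finset.mem_erase, mem_nonzeroCols] at hj
    obtain ⟨-, k, hk⟩ := hj
    refine ⟨k, Nat.pos_of_ne_zero fun h0 => ?_, hk⟩
    obtain rfl : k = ⟨0, hn⟩ := Fin.ext h0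
    exact hk (h j)

theorem mem_nonzeroCols_nuMat_mul {σ : Matrix (Fin n) (Fin n) K} {j : Fin n} :
    j ∈ nonzeroCols (nuMat n K * σ) ↔ ∃ k : Fin n, 0 < k.val ∧ σ k j ≠ 0 := by
  simp only [mem_nonzeroCols, nuMat_mul_ne_zero_iff]
  constructor
  · rintro ⟨i, k, hk, h⟩
    exact ⟨k, by omega, h⟩
  · rintro ⟨k, hk, h⟩
    exact ⟨⟨k.val - 1, by omega⟩, k, by simp only; omega, h⟩

theorem rank_le_rank_nuMat_mul (hn : 0 < n) {σ : Matrix (Fin n) (Fin n) K}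
    (hσ : σ ∈ rookMonoid n K) : σ.rank ≤ (nuMat n K * σ).rank + 1 := by
  obtain ⟨p, hp⟩ := exists_erase_subset hn hσ
  rw [rank_eq_card_nonzeroCols hσ, rank_eq_card_nonzeroCols (mul_mem nuMat_mem_rookMonoid hσ)]
  have h1 : ((nonzeroCols σ).erase p).card ≤ (nonzeroCols (nuMat n K * σ)).card :=
    Finset.card_le_card fun j hj => mem_nonzeroCols_nuMat_mul.2 (hp j hj)
  have h2 := Finset.pred_card_le_card_erase (s := nonzeroCols σ) (a := p)
  omega

/-- Every column with a nonzero entry below the first row meets the reach in the first row, and at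
most one nonzero column has no such entry. -/
theorem card_reach_nuMat_mul_le (hn : 0 < n) {σ : Matrix (Fin n) (Fin n) K}
    (hσ : σ ∈ rookMonoid n K) :
    (reach (nuMat n K * σ)).card + (σ.rank - 1) ≤ (reach σ).card := by
  obtain ⟨p, hp⟩ := exists_erase_subset hn hσ
  rw [card_reach_nuMat_mul hn σ, rank_eq_card_nonzeroCols hσ]
  have h1 : ((nonzeroCols σ).erase p).card ≤
      (Finset.univ.filter fun j => ((⟨0, hn⟩ : Fin n), j) ∈ reach σ).card := by
    refine Finset.card_le_card fun j hj => ?_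
    obtain ⟨k, hk, hk'⟩ := hp j hj
    rw [Finset.mem_filter, mem_reach]
    exact ⟨Finset.mem_univ _, Or.inl ⟨k, hk, hk'⟩⟩
  have h2 := Finset.pred_card_le_card_erase (s := nonzeroCols σ) (a := p)
  omega

/-- The case of equality. If all columns to the right of p are nonzero, the first row of the reach
consists exactly of the nonzero columns other than p. The reach then drops by as much as r(r-1)/2
does, so `scal` is unchanged. -/
theorem rank_and_card_reach_nuMat_mul (hn : 0 < n) {σ : Matrix (Fin n) (Fin n) K}
    (hσ : σ ∈ rookMonoid n K) {p : Fin n} (hp : σ ⟨0, hn⟩ p ≠ 0)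
    (h : ∀ j, p < j → ∃ k, σ k j ≠ 0) :
    σ.rank = (nuMat n K * σ).rank + 1 ∧
      (reach σ).card = (reach (nuMat n K * σ)).card + (nuMat n K * σ).rank := by
  have hpm : p ∈ nonzeroCols σ := mem_nonzeroCols.2 ⟨_, hp⟩
  have hk : ∀ k j, σ k j ≠ 0 → j ≠ p → 0 < k.val := by
    intro k j hkj hj
    refine Nat.pos_of_ne_zero fun h0 => hj ?_
    obtain rfl : k = ⟨0, hn⟩ := Fin.ext h0
    exact hσ.1 _ _ _ hkj hp
  have hk' : ∀ k, 0 < k.val → σ k p = 0 := by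
    intro k h0
    by_contra hkp
    have e : k = ⟨0, hn⟩ := hσ.2 _ _ _ hkp hp
    rw [e] at h0
    exact lt_irrefl _ h0
  have h1 : nonzeroCols (nuMat n K * σ) = (nonzeroCols σ).erase p := by
    ext j
    rw [mem_nonzeroCols_nuMat_mul, Finset.mem_erase, mem_nonzeroCols]
    constructor
    · rintro ⟨k, h0, hkj⟩
      refine ⟨?_, k, hkj⟩
      rintro rfl
      exact hkj (hk' k h0)
    · rintro ⟨hj, k, hkj⟩
      exact ⟨k, hk k j hkj hj, hkj⟩
  have h2 : (Finset.univ.filter fun j => ((⟨0, hn⟩ : Fin n), j) ∈ reach σ) =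
      (nonzeroCols σ).erase p := by
    ext j
    rw [Finset.mem_filter, mem_reach, Finset.mem_erase, mem_nonzeroCols]
    constructor
    · rintro ⟨-, ⟨k, h0, hkj⟩ | ⟨l, hl, hl'⟩⟩
      · refine ⟨?_, k, hkj⟩
        rintro rfl
        exact hkj (hk' k h0)
      · obtain rfl := hσ.1 _ _ _ hl' hp
        exact ⟨hl.ne', h j hl⟩
    · rintro ⟨hj, k, hkj⟩
      exact ⟨Finset.mem_univ _, Or.inl ⟨k, hk k j hkj hj, hkj⟩⟩
  rw [card_reach_nuMat_mul hn σ, h2, rank_eq_card_nonzeroCols hσ,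
    rank_eq_card_nonzeroCols (mul_mem nuMat_mem_rookMonoid hσ), h1]
  exact ⟨(Finset.card_erase_add_one hpm).symm, rfl⟩

end

/-! ### Left multiplication of `T σ` by the generators -/

section

variable {n : ℕ} {K : Type*} [Field K]

/-- The matrices `x` with `x U ⊆ U x`. -/
def leftAbsorbing (n : ℕ) (K : Type*) [Field K] : Submonoid (Matrix (Fin n) (Fin n) K) where
  carrier := {x | ∀ u ∈ unitriangular n K, ∃ v ∈ unitriangular n K, x * u = v * x}
  one_mem' := fun u hu => ⟨u, hu, by simp⟩
  mul_mem' := by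
    intro x y hx hy u hu
    obtain ⟨v, hv, e⟩ := hy u hu
    obtain ⟨w, hw, e'⟩ := hx v hv
    exact ⟨w, hw, by rw [mul_assoc, e, ← mul_assoc, e', mul_assoc]⟩

theorem mul_nuMat_apply (A : Matrix (Fin n) (Fin n) K) (i j : Fin n) :
    (A * nuMat n K) i j = if 0 < j.val then A i ⟨j.val - 1, by omega⟩ else 0 := by
  rw [mul_apply]
  split_ifs with h
  · rw [Finset.sum_eq_single ⟨j.val - 1, by omega⟩]
    · rw [nuMat, of_apply, if_pos (by simp only; omega), mul_one]
    · intro k _ hk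
      have := Fin.val_ne_iff.2 hk
      simp only at this
      rw [nuMat, of_apply, if_neg (by omega), mul_zero]
    · simp
  · refine Finset.sum_eq_zero fun k _ => ?_
    rw [nuMat, of_apply, if_neg (by omega), mul_zero]

theorem nuMat_mem_leftAbsorbing : nuMat n K ∈ leftAbsorbing n K := by
  intro u hu
  -- The witness is u without its first row and column, moved up and left, with a 1 in the vacated
  -- last corner.
  refine ⟨of fun i j => if h : i.val + 1 < n ∧ j.val + 1 < n then
    u ⟨i.val + 1, h.1⟩ ⟨j.val + 1, h.2⟩ else if i = j then 1 else 0, ⟨fun i => ?_, ?_⟩, ?_⟩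
  · rw [of_apply]
    split_ifs with h1 h2
    · exact hu.1 _
    · rfl
    · exact absurd rfl h2
  · intro i j hij
    rw [of_apply]
    split_ifs with h1 h2
    · refine hu.2 _ _ ?_
      rw [Fin.lt_def] at hij ⊢
      simpa using hij
    · exact absurd h2 hij.ne'
    · rfl
  · ext i j
    rw [nuMat_mul_apply, mul_nuMat_apply]
    by_cases hj : 0 < j.val
    · have e : j.val - 1 + 1 = j.val := by omega
      rw [if_pos hj, of_apply]
      by_cases hi : i.val + 1 < n
      · rw [dif_pos hi, dif_pos ⟨hi, by simp only; omega⟩]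
        congr 1
        exact Fin.ext e.symm
      · rw [dif_neg hi, dif_neg fun h => hi h.1, if_neg]
        rintro rfl
        simp only at hi
        omega
    · rw [if_neg hj]
      split_ifs with hi
      · refine hu.2 _ _ ?_
        rw [Fin.lt_def]
        simp only
        omega
      · rfl

/-- The diagonal matrix with given units on the diagonal. -/
def dMat (d : Fin n → Kˣ) : Matrix (Fin n) (Fin n) K := diagonal fun i => (d i : K)

theorem dMat_mul_apply (d : Fin n → Kˣ) (A : Matrix (Fin n) (Fin n) K) (i j : Fin n) :
    (dMat d * A) i j = d i * A i j := diagonal_mul _ _ _ _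

theorem mul_dMat_apply (d : Fin n → Kˣ) (A : Matrix (Fin n) (Fin n) K) (i j : Fin n) :
    (A * dMat d) i j = A i j * d j := mul_diagonal _ _ _ _

theorem dMat_mul_dMat (d e : Fin n → Kˣ) : dMat d * dMat e = dMat (d * e) := by
  simp [dMat, diagonal_mul_diagonal]

theorem dMat_one : dMat (1 : Fin n → Kˣ) = 1 := by
  simp [dMat]

theorem dMat_conj_mem (d : Fin n → Kˣ) {u : Matrix (Fin n) (Fin n) K}
    (hu : u ∈ unitriangular n K) : dMat d * u * dMat d⁻¹ ∈ unitriangular n K := by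
  refine ⟨fun i => ?_, fun i j h => ?_⟩
  · rw [mul_dMat_apply, dMat_mul_apply, hu.1]
    simp
  · rw [mul_dMat_apply, dMat_mul_apply, hu.2 i j h]
    simp

theorem dMat_mem_leftAbsorbing (d : Fin n → Kˣ) : dMat d ∈ leftAbsorbing n K := by
  intro u hu
  refine ⟨_, dMat_conj_mem d hu, ?_⟩
  rw [mul_assoc _ (dMat d⁻¹), dMat_mul_dMat, inv_mul_cancel, dMat_one, mul_one]

theorem mul_dMat_eq (d : Fin n → Kˣ) {u : Matrix (Fin n) (Fin n) K}
    (hu : u ∈ unitriangular n K) : ∃ v ∈ unitriangular n K, u * dMat d = dMat d * v := by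
  refine ⟨_, dMat_conj_mem d⁻¹ hu, ?_⟩
  rw [inv_inv, ← mul_assoc, ← mul_assoc, dMat_mul_dMat, mul_inv_cancel, dMat_one, one_mul]

theorem dMat_mem_rookMonoid (d : Fin n → Kˣ) : dMat d ∈ rookMonoid n K := by
  have h : ∀ i j, dMat d i j ≠ 0 → i = j := by
    intro i j h
    by_contra h0
    exact h (diagonal_apply_ne _ h0)
  exact ⟨fun i j j' h1 h2 => (h _ _ h1).symm.trans (h _ _ h2),
    fun i i' j h1 h2 => (h _ _ h1).trans (h _ _ h2).symm⟩

theorem dMat_mul_ne_zero_iff (d : Fin n → Kˣ) (σ : Matrix (Fin n) (Fin n) K) (i j : Fin n) :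
    (dMat d * σ) i j ≠ 0 ↔ σ i j ≠ 0 := by
  rw [dMat_mul_apply]
  simp

/-- Row `i` of `σ` has a nonzero entry to the left of every nonzero entry of row `j`. -/
def RowAscent (σ : Matrix (Fin n) (Fin n) K) (i j : Fin n) : Prop :=
  ∀ l, σ j l ≠ 0 → ∃ m < l, σ i m ≠ 0

/-- Adding a multiple of row j to row i creates one entry, to the right of the entry of row i. The
same change is made by a column operation from column m to a column l > m, which lies in U. -/
theorem transvection_mul_eq {i j : Fin n} (hij : i ≠ j) {σ : Matrix (Fin n) (Fin n) K}
    (hσ : σ ∈ rookMonoid n K) (h : RowAscent σ i j) (b : K) :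
    ∃ v ∈ unitriangular n K, transvection i j b * σ = σ * v := by
  by_cases hj : ∃ l, σ j l ≠ 0
  · obtain ⟨l, hl⟩ := hj
    obtain ⟨m, hm, hm'⟩ := h l hl
    refine ⟨_, transvection_mem hm (b * σ j l / σ i m), ?_⟩
    ext k r
    rcases eq_or_ne r l with rfl | hr
    · rw [mul_transvection_apply_same]
      rcases eq_or_ne k i with rfl | hk
      · rw [transvection_mul_apply_same, div_mul_cancel₀ _ hm']
      · rw [transvection_mul_apply_of_ne _ _ _ _ hk]
        by_cases h0 : σ k m = 0
        · rw [h0, mul_zero, add_zero]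
        · exact absurd (hσ.2 _ _ _ h0 hm') hk
    · rw [mul_transvection_apply_of_ne _ _ _ _ hr]
      rcases eq_or_ne k i with rfl | hk
      · rw [transvection_mul_apply_same]
        by_cases h0 : σ j r = 0
        · rw [h0, mul_zero, add_zero]
        · exact absurd (hσ.1 _ _ _ h0 hl) hr
      · rw [transvection_mul_apply_of_ne _ _ _ _ hk]
  · push Not at hj
    refine ⟨1, one_mem _, ?_⟩
    ext k r
    rw [mul_one]
    rcases eq_or_ne k i with rfl | hk
    · rw [transvection_mul_apply_same, hj, mul_zero, add_zero]
    · rw [transvection_mul_apply_of_ne _ _ _ _ hk]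

theorem rowAscent_swap_mul {i j : Fin n} {σ : Matrix (Fin n) (Fin n) K}
    (hσ : σ ∈ rookMonoid n K) (hij : i ≠ j) (h : ¬ RowAscent σ i j) :
    RowAscent (swap K i j * σ) i j := by
  unfold RowAscent at h
  push Not at h
  obtain ⟨l, hl, hl'⟩ := h
  intro m hm
  rw [swap_mul_apply, Equiv.swap_apply_right] at hm
  refine ⟨l, lt_of_le_of_ne (not_lt.1 fun hml => hm (hl' m hml)) ?_, ?_⟩
  · rintro rfl
    exact hij (hσ.2 _ _ _ hm hl)
  · rwa [swap_mul_apply, Equiv.swap_apply_left]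

/-- The diagonal part of the Bruhat decomposition of `1 + b E_{j,i}`. -/
def bruhatDiag (i j : Fin n) (b : Kˣ) : Fin n → Kˣ :=
  fun k => if k = i then -b⁻¹ else if k = j then b else 1

/-- A 2 × 2 identity. The lower unipotent factor is written as a conjugate by the transposition so
that, applied to σ, its transvection acts on the row-swapped σ, where `transvection_mul_eq` is
available. -/
theorem swap_mul_transvection {i j : Fin n} (hij : i ≠ j) (b : Kˣ) :
    swap K i j * transvection i j (b : K) = transvection i j ((b⁻¹ : Kˣ) : K) *
      (dMat (bruhatDiag i j b) * (swap K i j *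
        (transvection i j ((b⁻¹ : Kˣ) : K) * swap K i j))) := by
  ext k r
  rw [swap_mul_apply]
  rcases eq_or_ne k i with rfl | hki
  · have e : transvection k j (b : K) j r = (1 : Matrix (Fin n) (Fin n) K) j r := by
      rw [← mul_one (transvection k j (b : K)), transvection_mul_apply_of_ne _ _ _ _ hij.symm]
    rw [Equiv.swap_apply_left, transvection_mul_apply_same, dMat_mul_apply, dMat_mul_apply,
      swap_mul_apply, swap_mul_apply, Equiv.swap_apply_left, Equiv.swap_apply_right,
      transvection_mul_apply_same, transvection_mul_apply_of_ne _ _ _ _ hij.symm, e,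
      ← mul_one (swap K k j), swap_mul_apply, swap_mul_apply, Equiv.swap_apply_left,
      Equiv.swap_apply_right]
    simp only [bruhatDiag, if_true, if_neg hij.symm]
    have := b.ne_zero
    push_cast
    field_simp
    ring
  · rw [transvection_mul_apply_of_ne _ _ _ _ hki, dMat_mul_apply, swap_mul_apply]
    rcases eq_or_ne k j with rfl | hkj
    · have e : transvection i k (b : K) i r = (1 : Matrix (Fin n) (Fin n) K) i r +
          b * (1 : Matrix (Fin n) (Fin n) K) k r := by
        rw [← mul_one (transvection i k (b : K)), transvection_mul_apply_same]
      rw [Equiv.swap_apply_right, transvection_mul_apply_same, e,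
        ← mul_one (swap K i k), swap_mul_apply, swap_mul_apply, Equiv.swap_apply_left,
        Equiv.swap_apply_right]
      simp only [bruhatDiag, if_true, if_neg hki]
      have := b.ne_zero
      push_cast
      field_simp
      ring
    · have e : transvection i j (b : K) k r = (1 : Matrix (Fin n) (Fin n) K) k r := by
        rw [← mul_one (transvection i j (b : K)), transvection_mul_apply_of_ne _ _ _ _ hki]
      rw [Equiv.swap_apply_of_ne_of_ne hki hkj, transvection_mul_apply_of_ne _ _ _ _ hki, e,
        ← mul_one (swap K i j), swap_mul_apply, Equiv.swap_apply_of_ne_of_ne hki hkj]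
      simp [bruhatDiag, if_neg hki, if_neg hkj]

theorem rowAscent_one {i j : Fin n} (hij : i.val + 1 = j.val) :
    RowAscent (1 : Matrix (Fin n) (Fin n) K) i j := by
  intro l hl
  obtain rfl : j = l := by
    by_contra h
    exact hl (one_apply_ne h)
  exact ⟨i, by rw [Fin.lt_def]; omega, by simp⟩

variable [Fintype K]

theorem scal_eq {σ : Matrix (Fin n) (Fin n) K} (hσ : σ ∈ rookMonoid n K) :
    scal σ = ((Fintype.card K : ℚ) ^ (σ.rank * (σ.rank - 1) / 2))⁻¹ *
      (Fintype.card K : ℚ) ^ (reach σ).card := by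
  rw [scal, card_doubleClass hσ, Nat.cast_pow]

theorem scal_congr {σ τ : Matrix (Fin n) (Fin n) K} (hσ : σ ∈ rookMonoid n K)
    (hτ : τ ∈ rookMonoid n K) (h : ∀ i j, σ i j ≠ 0 ↔ τ i j ≠ 0) : scal σ = scal τ := by
  rw [scal_eq hσ, scal_eq hτ, rank_eq_card_nonzeroCols hσ, rank_eq_card_nonzeroCols hτ,
    reach_congr h, nonzeroCols_congr h]

theorem scal_one : scal (1 : Matrix (Fin n) (Fin n) K) = 1 := by
  rw [scal_eq (one_mem _), rank_one, Fintype.card_fin, card_reach_one]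
  exact inv_mul_cancel₀ (pow_ne_zero _ card_field_ne_zero)

theorem T_one : T (1 : Matrix (Fin n) (Fin n) K) = 1 := by
  rw [T_eq, scal_one, one_smul, bi_one]

theorem scal_swap_mul {i j : Fin n} (hij : i.val + 1 = j.val)
    {σ : Matrix (Fin n) (Fin n) K} (hσ : σ ∈ rookMonoid n K) {p : Fin n} (hp : σ i p ≠ 0)
    (h : RowAscent σ i j) : scal (swap K i j * σ) = Fintype.card K * scal σ := by
  have hc : ∀ l, σ j l ≠ 0 → p < l := by
    intro l hl
    obtain ⟨m, hm, hm'⟩ := h l hl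
    rwa [hσ.1 _ _ _ hp hm']
  rw [scal_eq hσ, scal_eq (mul_mem (swap_mem_rookMonoid i j) hσ), rank_swap_mul,
    card_reach_swap_mul hij hσ hp hc, pow_succ]
  ring

theorem scal_swap {i j : Fin n} (hij : i.val + 1 = j.val) :
    scal (swap K i j) = Fintype.card K := by
  have h := scal_swap_mul hij (one_mem (rookMonoid n K)) (p := i) (by simp) (rowAscent_one hij)
  rwa [mul_one, scal_one, mul_one] at h

theorem scal_nuMat_mul (hn : 0 < n) {σ : Matrix (Fin n) (Fin n) K}
    (hσ : σ ∈ rookMonoid n K) {p : Fin n} (hp : σ ⟨0, hn⟩ p ≠ 0)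
    (h : ∀ j, p < j → ∃ k, σ k j ≠ 0) : scal (nuMat n K * σ) = scal σ := by
  obtain ⟨h1, h2⟩ := rank_and_card_reach_nuMat_mul hn hσ hp h
  rw [scal_eq hσ, scal_eq (mul_mem nuMat_mem_rookMonoid hσ), h1, h2, Nat.triangle_succ,
    pow_add, pow_add, mul_inv]
  have := card_field_ne_zero (K := K)
  field_simp

theorem scal_nuMat (hn : 0 < n) : scal (nuMat n K) = 1 := by
  have h := scal_nuMat_mul hn (one_mem (rookMonoid n K)) (p := ⟨0, hn⟩) (by simp)
    fun j _ => ⟨j, by simp⟩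
  rwa [mul_one, scal_one] at h

/-- The integrality behind N. Since the rank drops by at most one, r(r-1)/2 drops by at most r - 1,
while the reach drops by at least r - 1. Hence the difference of exponents is a natural number, and
the subtraction in the witness does not truncate. -/
theorem exists_scal_eq (hn : 0 < n) {σ : Matrix (Fin n) (Fin n) K}
    (hσ : σ ∈ rookMonoid n K) :
    ∃ e : ℕ, scal σ = (Fintype.card K : ℚ) ^ e * scal (nuMat n K * σ) := by
  have h1 := rank_le_rank_nuMat_mul hn hσ
  have h2 := card_reach_nuMat_mul_le hn hσ
  rw [scal_eq hσ, scal_eq (mul_mem nuMat_mem_rookMonoid hσ)]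
  set r := σ.rank
  set r' := (nuMat n K * σ).rank
  have h3 : r * (r - 1) / 2 ≤ r' * (r' - 1) / 2 + (r - 1) := by
    rw [← Nat.choose_two_right, ← Nat.choose_two_right]
    rcases Nat.eq_zero_or_pos r with h | h
    · rw [h]
      simp
    · obtain ⟨s, hs⟩ := Nat.exists_eq_succ_of_ne_zero h.ne'
      rw [hs, Nat.succ_eq_add_one, Nat.choose_succ_succ' s 1, Nat.choose_one_right]
      change s + s.choose 2 ≤ _
      have := Nat.choose_le_choose 2 (show s ≤ r' by omega)
      simp only [Nat.add_sub_cancel]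
      omega
  refine ⟨(reach σ).card + r' * (r' - 1) / 2 -
    (r * (r - 1) / 2 + (reach (nuMat n K * σ)).card), ?_⟩
  have := card_field_ne_zero (K := K)
  field_simp
  rw [← pow_add, ← pow_add, ← pow_add]
  congr 1
  omega

theorem bi_swap_mul_bi_of_rowAscent {i j : Fin n} (hij : i.val + 1 = j.val)
    {σ : Matrix (Fin n) (Fin n) K} (hσ : σ ∈ rookMonoid n K) (h : RowAscent σ i j) :
    bi (swap K i j) * bi σ = bi (swap K i j * σ) := by
  rw [bi_swap_mul_bi hij, Finset.sum_congr rfl (g := fun _ => bi (swap K i j * σ)),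
    Finset.sum_const, Finset.card_univ, ← Nat.cast_smul_eq_nsmul ℚ,
    inv_smul_smul₀ card_field_ne_zero]
  intro b _
  obtain ⟨v, hv, e⟩ := transvection_mul_eq (Fin.ne_of_val_ne (by omega)) hσ h b
  rw [e, ← mul_assoc, bi_right hv]

theorem sum_eq_zero_add_sum_units [Fintype Kˣ] {A : Type*} [AddCommMonoid A] (f : K → A) :
    ∑ b, f b = f 0 + ∑ b : Kˣ, f b := by
  classical
  rw [← Finset.add_sum_erase _ _ (Finset.mem_univ (0 : K))]
  congr 1
  refine (Finset.sum_nbij (fun b : Kˣ => (b : K)) ?_ ?_ ?_ fun _ _ => rfl).symm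
  · simp
  · exact Units.val_injective.injOn
  · intro b hb
    have hb : b ≠ 0 := by simpa using hb
    exact ⟨Units.mk0 b hb, by simp, rfl⟩

/-- The parameter b = 0 gives the first term. For b ≠ 0 the Bruhat decomposition applies: its left
transvection is absorbed by ε, its right one passes through the row-swapped σ, which has an ascent,
and the two transpositions cancel. -/
theorem bi_swap_mul_bi_of_not_rowAscent [Fintype Kˣ] {i j : Fin n} (hij : i.val + 1 = j.val)
    {σ : Matrix (Fin n) (Fin n) K} (hσ : σ ∈ rookMonoid n K) (h : ¬ RowAscent σ i j) :
    (Fintype.card K : ℚ) • (bi (swap K i j) * bi σ) =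
      bi (swap K i j * σ) + ∑ b : Kˣ, bi (dMat (bruhatDiag i j b) * σ) := by
  have hne : i ≠ j := Fin.ne_of_val_ne (by omega)
  have hlt : i < j := by rw [Fin.lt_def]; omega
  rw [bi_swap_mul_bi hij, smul_inv_smul₀ card_field_ne_zero, sum_eq_zero_add_sum_units,
    transvection_zero, one_mul]
  congr 1
  refine Finset.sum_congr rfl fun b _ => ?_
  obtain ⟨v, hv, e⟩ := transvection_mul_eq hne (mul_mem (swap_mem_rookMonoid i j) hσ)
    (rowAscent_swap_mul hσ hne h) ((b⁻¹ : Kˣ) : K)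
  rw [← mul_assoc, swap_mul_transvection hne b, mul_assoc, mul_assoc, mul_assoc, mul_assoc, e,
    bi_left (transvection_mem hlt _), ← mul_assoc, ← mul_assoc, bi_right hv, mul_assoc,
    ← mul_assoc (swap K i j), swap_mul_self, one_mul]

theorem smul_mul_smul' (c d : ℚ) (x y : Ambient n K) : c • x * d • y = (c * d) • (x * y) := by
  rw [smul_mul_assoc, mul_smul_comm, smul_smul]

theorem T_swap_mul_of_rowAscent {i j : Fin n} (hij : i.val + 1 = j.val)
    {σ : Matrix (Fin n) (Fin n) K} (hσ : σ ∈ rookMonoid n K) {p : Fin n} (hp : σ i p ≠ 0)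
    (h : RowAscent σ i j) : T (swap K i j) * T σ = T (swap K i j * σ) := by
  rw [T_eq, T_eq, T_eq, smul_mul_smul', bi_swap_mul_bi_of_rowAscent hij hσ h, scal_swap hij,
    scal_swap_mul hij hσ hp h]

theorem T_swap_mul_of_swap_mul_eq {i j : Fin n} (hij : i.val + 1 = j.val)
    {σ : Matrix (Fin n) (Fin n) K} (hσ : σ ∈ rookMonoid n K)
    (h : RowAscent σ i j) (e : swap K i j * σ = σ) :
    T (swap K i j) * T σ = (Fintype.card K : ℚ) • T σ := by
  rw [T_eq, T_eq, smul_mul_smul', bi_swap_mul_bi_of_rowAscent hij hσ h, scal_swap hij, e,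
    mul_smul]

theorem T_dMat (d : Fin n → Kˣ) : T (dMat d) = bi (dMat d) := by
  rw [T_eq, scal_congr (dMat_mem_rookMonoid d) (one_mem _), scal_one, one_smul]
  intro i j
  rw [← mul_one (dMat d), dMat_mul_ne_zero_iff]

theorem T_dMat_mul (d : Fin n → Kˣ) {σ : Matrix (Fin n) (Fin n) K}
    (hσ : σ ∈ rookMonoid n K) : T (dMat d) * T σ = T (dMat d * σ) := by
  rw [T_dMat, T_eq, T_eq, mul_smul_comm, bi_mul_bi_of_left (dMat_mem_leftAbsorbing d),
    scal_congr (mul_mem (dMat_mem_rookMonoid d) hσ) hσ (dMat_mul_ne_zero_iff d σ)]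

theorem T_swap_mul_of_not_rowAscent [Fintype Kˣ] {i j : Fin n} (hij : i.val + 1 = j.val)
    {σ : Matrix (Fin n) (Fin n) K} (hσ : σ ∈ rookMonoid n K) (h : ¬ RowAscent σ i j) :
    T (swap K i j) * T σ = (Fintype.card K : ℚ) • T (swap K i j * σ) +
      ∑ b : Kˣ, T (dMat (bruhatDiag i j b)) * T σ := by
  have hne : i ≠ j := Fin.ne_of_val_ne (by omega)
  -- The descent of σ is an ascent of the row-swapped matrix, so the length rule applies to the
  -- latter. This factor q becomes the coefficient of the first term.
  have hs : scal σ = Fintype.card K * scal (swap K i j * σ) := by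
    have h1 := rowAscent_swap_mul hσ hne h
    unfold RowAscent at h
    push Not at h
    obtain ⟨p, hp, -⟩ := h
    have h2 := scal_swap_mul hij (mul_mem (swap_mem_rookMonoid i j) hσ) (p := p)
      (by rwa [swap_mul_apply, Equiv.swap_apply_left]) h1
    rwa [← mul_assoc, swap_mul_self, one_mul] at h2
  have hd : ∀ b, T (dMat (bruhatDiag i j b)) * T σ =
      scal σ • bi (dMat (bruhatDiag i j b) * σ) := by
    intro b
    rw [T_dMat_mul _ hσ, T_eq,
      scal_congr (mul_mem (dMat_mem_rookMonoid _) hσ) hσ (dMat_mul_ne_zero_iff _ σ)]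
  rw [Finset.sum_congr rfl fun b _ => hd b, ← Finset.smul_sum, T_eq (swap K i j * σ), smul_smul,
    ← hs]
  refine Eq.trans ?_ (smul_add (scal σ) _ _)
  rw [← bi_swap_mul_bi_of_not_rowAscent hij hσ h, T_eq, T_eq, smul_mul_smul',
    scal_swap hij, smul_smul, mul_comm]

theorem genN_eq (hn : 0 < n) : genN n K = bi (nuMat n K) := by
  rw [genN, T_eq, scal_nuMat hn, one_smul]

theorem genN_mul_T (hn : 0 < n) {σ : Matrix (Fin n) (Fin n) K} (hσ : σ ∈ rookMonoid n K) :
    ∃ e : ℕ, genN n K * T σ = (Fintype.card K : ℚ) ^ e • T (nuMat n K * σ) := by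
  obtain ⟨e, he⟩ := exists_scal_eq hn hσ
  refine ⟨e, ?_⟩
  rw [genN_eq hn, T_eq, T_eq, mul_smul_comm, bi_mul_bi_of_left nuMat_mem_leftAbsorbing, he,
    smul_smul]

theorem genN_mul_T_of_ne_zero (hn : 0 < n) {σ : Matrix (Fin n) (Fin n) K}
    (hσ : σ ∈ rookMonoid n K) {p : Fin n} (hp : σ ⟨0, hn⟩ p ≠ 0)
    (h : ∀ j, p < j → ∃ k, σ k j ≠ 0) : genN n K * T σ = T (nuMat n K * σ) := by
  rw [genN_eq hn, T_eq, T_eq, mul_smul_comm, bi_mul_bi_of_left nuMat_mem_leftAbsorbing,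
    scal_nuMat_mul hn hσ hp h]

end

/-! ### Matrix identities, braid relations and the diagonal torus -/

section

variable {n : ℕ} {K : Type*} [Field K]

theorem swap_ne_zero_iff {i j k l : Fin n} : swap K i j k l ≠ 0 ↔ Equiv.swap i j k = l := by
  rw [← mul_one (swap K i j), swap_mul_apply, one_apply]
  simp

theorem mul_swap_apply {i j : Fin n} (σ : Matrix (Fin n) (Fin n) K) (k l : Fin n) :
    (σ * swap K i j) k l = σ k (Equiv.swap i j l) := by
  rw [swap, PEquiv.mul_toMatrix_toPEquiv, Equiv.symm_swap]
  rfl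

theorem rowAscent_of_lt {σ : Matrix (Fin n) (Fin n) K} {i j p : Fin n} (hp : σ i p ≠ 0)
    (h : ∀ l, σ j l ≠ 0 → p < l) : RowAscent σ i j :=
  fun l hl => ⟨p, h l hl, hp⟩

theorem rowAscent_of_eq_zero {σ : Matrix (Fin n) (Fin n) K} {i j : Fin n}
    (h : ∀ l, σ j l = 0) : RowAscent σ i j :=
  fun l hl => absurd (h l) hl

theorem swap_mul_swap_mul_swap {i j k : Fin n} (hij : i ≠ j) (hik : i ≠ k) (hjk : j ≠ k) :
    swap K i j * (swap K j k * swap K i j) = swap K j k * (swap K i j * swap K j k) := by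
  ext p r
  simp only [swap_mul_apply]
  have e : Equiv.swap j k (Equiv.swap i j p) = Equiv.swap i j (Equiv.swap j k
      (Equiv.swap i j (Equiv.swap j k p))) := by
    simp only [Equiv.swap_apply_def]
    grind
  have h : ∀ x y : Fin n, Equiv.swap i j x = y → swap K i j x r = (1 : Matrix _ _ K) y r := by
    rintro x _ rfl
    rw [← mul_one (swap K i j), swap_mul_apply]
  have h' : ∀ x y : Fin n, Equiv.swap j k x = y → swap K j k x r = (1 : Matrix _ _ K) y r := by
    rintro x _ rfl
    rw [← mul_one (swap K j k), swap_mul_apply]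
  rw [h' _ _ rfl]
  refine h _ _ ?_
  rw [e, Equiv.swap_apply_self]

theorem swap_mul_swap_comm {i j k l : Fin n} (hik : i ≠ k) (hil : i ≠ l) (hjk : j ≠ k)
    (hjl : j ≠ l) : swap K i j * swap K k l = swap K k l * swap K i j := by
  ext p r
  rw [← mul_one (swap K i j * _), ← mul_one (swap K k l * _), mul_assoc, mul_assoc,
    swap_mul_apply, swap_mul_apply, swap_mul_apply, swap_mul_apply]
  have e : Equiv.swap k l (Equiv.swap i j p) = Equiv.swap i j (Equiv.swap k l p) := by
    simp only [Equiv.swap_apply_def]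
    grind
  rw [e]

/-- Generators are numbered from 1 and positions from 0: number k exchanges positions k - 1 and k,
whence k = j. -/
theorem sMat_eq {i j : Fin n} (hij : i.val + 1 = j.val) {k : ℕ} (hk : k = j.val) :
    sMat n K k = swap K i j := by
  ext p r
  rw [← mul_one (swap K i j), swap_mul_apply, one_apply, sMat, of_apply]
  subst hk
  congr 1
  simp only [Equiv.swap_apply_def, eq_iff_iff, Fin.ext_iff]
  split_ifs <;> omega

theorem aMat_eq (a : Kˣ) {i : Fin n} {k : ℕ} (hk : k = i.val + 1) :
    aMat n a k = dMat (Pi.mulSingle i a) := by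
  subst hk
  rw [aMat, dMat]
  congr 1
  ext p
  rcases eq_or_ne p i with rfl | h
  · simp
  · rw [Pi.mulSingle_eq_of_ne h, if_neg fun e => h (Fin.ext (by omega)), Units.val_one]

theorem swap_mul_dMat (i j : Fin n) (d : Fin n → Kˣ) :
    swap K i j * dMat d = dMat (fun k => d (Equiv.swap i j k)) * swap K i j := by
  ext k l
  rw [mul_dMat_apply, dMat_mul_apply]
  by_cases h : swap K i j k l = 0
  · rw [h, zero_mul, mul_zero]
  · rw [← swap_ne_zero_iff.1 h, mul_comm]

theorem mulSingle_comp_swap (i j k : Fin n) (a : Kˣ) :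
    (fun l => (Pi.mulSingle k a : Fin n → Kˣ) (Equiv.swap i j l)) =
      Pi.mulSingle (Equiv.swap i j k) a := by
  ext l
  simp only [Pi.mulSingle_apply, Equiv.swap_apply_eq_iff]

theorem nuMat_pow_apply (m : ℕ) (i j : Fin n) :
    (nuMat n K ^ m) i j = if i.val + m = j.val then 1 else 0 := by
  induction m generalizing i with
  | zero => simp [one_apply, Fin.ext_iff]
  | succ m ih =>
    rw [pow_succ', nuMat_mul_apply]
    split_ifs with h1 h2 h2
    · rw [ih, if_pos (by simp only; omega)]
    · rw [ih, if_neg (by simp only; omega)]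
    · omega
    · rfl

/-- The matrix obtained from `ν` by moving its zero row to position `k`. -/
def etaMat (n : ℕ) (K : Type*) [Field K] (k : ℕ) : Matrix (Fin n) (Fin n) K :=
  of fun p r => if (p.val < k ∧ r.val = p.val + 1) ∨ (k < p.val ∧ r = p) then 1 else 0

theorem etaMat_ne_zero_iff {k : ℕ} {p r : Fin n} :
    etaMat n K k p r ≠ 0 ↔ (p.val < k ∧ r.val = p.val + 1) ∨ (k < p.val ∧ r = p) := by
  rw [etaMat, of_apply]
  split_ifs with h <;> simp [h]

theorem etaMat_mem_rookMonoid (k : ℕ) : etaMat n K k ∈ rookMonoid n K := by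
  constructor <;>
  · intro _ _ _ h h'
    rw [etaMat_ne_zero_iff] at h h'
    simp only [Fin.ext_iff] at *
    omega

/-- The matrices `etaMat n K k` interpolate between ν, at k = n - 1, and a matrix at k = 0 that
satisfies νη = ν. Each adjacent transposition moves the zero row up by one, which evaluates the word
in the last relation. -/
theorem swap_mul_etaMat {i j : Fin n} (hij : i.val + 1 = j.val) :
    swap K i j * etaMat n K j.val = etaMat n K i.val := by
  ext p r
  rw [swap_mul_apply, etaMat, etaMat, of_apply, of_apply]
  congr 1
  simp only [Equiv.swap_apply_def, eq_iff_iff, Fin.ext_iff]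
  split_ifs <;> omega

theorem etaMat_last : etaMat n K (n - 1) = nuMat n K := by
  ext p r
  rw [etaMat, nuMat, of_apply, of_apply]
  congr 1
  simp only [eq_iff_iff, Fin.ext_iff]
  omega

theorem nuMat_mul_etaMat_zero : nuMat n K * etaMat n K 0 = nuMat n K := by
  ext p r
  rw [nuMat_mul_apply]
  simp only [etaMat, nuMat, of_apply, Fin.ext_iff]
  split_ifs <;> first | rfl | omega

/-- The power squares to 1 and differs from 1 because a has order q - 1. It accounts for the sign in
`bruhatDiag`. -/
theorem pow_half_eq_neg_one [Fintype K] (hq : Odd (Fintype.card K)) {a : Kˣ}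
    (ha : ∀ x : Kˣ, x ∈ Subgroup.zpowers a) : a ^ ((Fintype.card K - 1) / 2) = -1 := by
  have h1 : orderOf a = Fintype.card K - 1 := by
    rw [orderOf_eq_card_of_forall_mem_zpowers ha, Nat.card_units, Nat.card_eq_fintype_card]
  have h2 : 1 < Fintype.card K := Fintype.one_lt_card
  obtain ⟨m, hm⟩ := hq
  have h3 : (a ^ ((Fintype.card K - 1) / 2)) ^ 2 = 1 := by
    rw [← pow_mul, Nat.div_mul_cancel ⟨m, by omega⟩, ← h1, pow_orderOf_eq_one]
  have h4 : ((a ^ ((Fintype.card K - 1) / 2) : Kˣ) : K) ^ 2 = 1 := by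
    rw [← Units.val_pow_eq_pow_val, h3, Units.val_one]
  rcases sq_eq_one_iff.1 h4 with h | h
  · have := orderOf_dvd_of_pow_eq_one (Units.ext h)
    rw [h1] at this
    have := Nat.le_of_dvd (by omega) this
    omega
  · exact Units.ext (by simpa using h)

variable [Fintype K]

theorem T_swap_eq {i j : Fin n} (hij : i.val + 1 = j.val) :
    T (swap K i j) = (Fintype.card K : ℚ) • bi (swap K i j) := by
  rw [T_eq, scal_swap hij]

/-- Each product on either side is taken at an ascent, so both sides equal `T` of the same
permutation matrix. -/
theorem T_braid {i j k : Fin n} (hij : i.val + 1 = j.val) (hjk : j.val + 1 = k.val) :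
    T (swap K i j) * T (swap K j k) * T (swap K i j) =
      T (swap K j k) * T (swap K i j) * T (swap K j k) := by
  have h1 : i ≠ j := Fin.ne_of_val_ne (by omega)
  have h2 : i ≠ k := Fin.ne_of_val_ne (by omega)
  have h3 : j ≠ k := Fin.ne_of_val_ne (by omega)
  have l1 : i < j := by rw [Fin.lt_def]; omega
  have l3 : j < k := by rw [Fin.lt_def]; omega
  rw [mul_assoc, mul_assoc]
  rw [T_swap_mul_of_rowAscent hij (swap_mem_rookMonoid j k) (p := i),
    T_swap_mul_of_rowAscent hjk (swap_mem_rookMonoid i j) (p := i),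
    T_swap_mul_of_rowAscent hij (mul_mem (swap_mem_rookMonoid j k) (swap_mem_rookMonoid i j))
      (p := j),
    T_swap_mul_of_rowAscent hjk (mul_mem (swap_mem_rookMonoid i j) (swap_mem_rookMonoid j k))
      (p := i),
    swap_mul_swap_mul_swap h1 h2 h3]
  · rw [swap_mul_apply, swap_ne_zero_iff, Equiv.swap_apply_right,
      Equiv.swap_apply_of_ne_of_ne h1 h2]
  · refine rowAscent_of_lt (p := i) ?_ fun l hl => ?_
    · rw [swap_mul_apply, swap_ne_zero_iff, Equiv.swap_apply_right,
        Equiv.swap_apply_of_ne_of_ne h1 h2]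
    · rw [swap_mul_apply, swap_ne_zero_iff, Equiv.swap_apply_of_ne_of_ne h2.symm h3.symm,
        Equiv.swap_apply_right] at hl
      rwa [← hl]
  · rw [swap_mul_apply, swap_ne_zero_iff, Equiv.swap_apply_of_ne_of_ne h1 h2,
      Equiv.swap_apply_left]
  · refine rowAscent_of_lt (p := j) ?_ fun l hl => ?_
    · rw [swap_mul_apply, swap_ne_zero_iff, Equiv.swap_apply_of_ne_of_ne h1 h2,
        Equiv.swap_apply_left]
    · rw [swap_mul_apply, swap_ne_zero_iff, Equiv.swap_apply_left,
        Equiv.swap_apply_of_ne_of_ne h2.symm h3.symm] at hl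
      rwa [← hl]
  · rw [swap_ne_zero_iff, Equiv.swap_apply_right]
  · refine rowAscent_of_lt (p := i) ?_ fun l hl => ?_
    · rw [swap_ne_zero_iff, Equiv.swap_apply_right]
    · rw [swap_ne_zero_iff, Equiv.swap_apply_of_ne_of_ne h2.symm h3.symm] at hl
      exact hl ▸ l1.trans l3
  · rw [swap_ne_zero_iff, Equiv.swap_apply_of_ne_of_ne h1 h2]
  · refine rowAscent_of_lt (p := i) ?_ fun l hl => ?_
    · rw [swap_ne_zero_iff, Equiv.swap_apply_of_ne_of_ne h1 h2]
    · rw [swap_ne_zero_iff, Equiv.swap_apply_left] at hl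
      exact hl ▸ l1.trans l3

theorem T_swap_mul_T_swap {i j k l : Fin n} (hij : i.val + 1 = j.val) (hik : i ≠ k)
    (hil : i ≠ l) (hjk : j ≠ k) (hjl : j ≠ l) :
    T (swap K i j) * T (swap K k l) = T (swap K i j * swap K k l) := by
  refine T_swap_mul_of_rowAscent hij (swap_mem_rookMonoid k l) (p := i) ?_
    (rowAscent_of_lt (p := i) ?_ fun m hm => ?_)
  · rw [swap_ne_zero_iff, Equiv.swap_apply_of_ne_of_ne hik hil]
  · rw [swap_ne_zero_iff, Equiv.swap_apply_of_ne_of_ne hik hil]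
  · rw [swap_ne_zero_iff, Equiv.swap_apply_of_ne_of_ne hjk hjl] at hm
    rw [← hm, Fin.lt_def]
    omega

theorem T_swap_comm {i j k l : Fin n} (hij : i.val + 1 = j.val) (hkl : k.val + 1 = l.val)
    (hik : i ≠ k) (hil : i ≠ l) (hjk : j ≠ k) (hjl : j ≠ l) :
    T (swap K i j) * T (swap K k l) = T (swap K k l) * T (swap K i j) := by
  rw [T_swap_mul_T_swap hij hik hil hjk hjl,
    T_swap_mul_T_swap hkl hik.symm hjk.symm hil.symm hjl.symm,
    swap_mul_swap_comm hik hil hjk hjl]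

/-- The homomorphism `d ↦ T_d` on invertible diagonal matrices. -/
def diagHom (n : ℕ) (K : Type*) [Field K] [Fintype K] : (Fin n → Kˣ) →* Ambient n K where
  toFun d := T (dMat d)
  map_one' := by rw [dMat_one, T_one]
  map_mul' d e := by rw [T_dMat_mul d (dMat_mem_rookMonoid e), dMat_mul_dMat]

theorem inverse_diagHom (d : Fin n → Kˣ) :
    Ring.inverse (diagHom n K d) = diagHom n K d⁻¹ := by
  have h1 : diagHom n K d * diagHom n K d⁻¹ = 1 := by rw [← map_mul, mul_inv_cancel, map_one]
  have h2 : diagHom n K d⁻¹ * diagHom n K d = 1 := by rw [← map_mul, inv_mul_cancel, map_one]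
  exact Ring.inverse_unit (⟨_, _, h1, h2⟩ : (Ambient n K)ˣ)

theorem genF_eq (a : Kˣ) {i : Fin n} {k : ℕ} (hk : k = i.val + 1) :
    genF n a k = diagHom n K (Pi.mulSingle i a) := by
  rw [genF, aMat_eq a hk]
  rfl

theorem genT_eq {i j : Fin n} (hij : i.val + 1 = j.val) {k : ℕ} (hk : k = j.val) :
    genT n K k = T (swap K i j) := by
  rw [genT, sMat_eq hij hk]

theorem sum_bruhatDiag [Fintype Kˣ] (hq : Odd (Fintype.card K)) {a : Kˣ}
    (ha : ∀ x : Kˣ, x ∈ Subgroup.zpowers a) {i j : Fin n} (hij : i.val + 1 = j.val) {k : ℕ}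
    (hk : k = j.val) :
    ∑ b : Kˣ, T (dMat (bruhatDiag i j b)) = ((Fintype.card K : ℚ) - 1) •
      (genF n a k ^ ((Fintype.card K - 1) / 2) * elemE n a k) := by
  classical
  have hne : i ≠ j := Fin.ne_of_val_ne (by omega)
  have h0 : (Fintype.card K : ℚ) - 1 ≠ 0 := by
    have : (1 : ℚ) < Fintype.card K := by exact_mod_cast Fintype.one_lt_card
    linarith
  rw [elemE, mul_smul_comm, smul_inv_smul₀ h0, Finset.mul_sum,
    genF_eq a (i := i) (by omega), genF_eq a (i := j) (by omega), inverse_diagHom]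
  -- The units are enumerated as b = a^{-m}: then the entries -b⁻¹ at i and b at j are those of
  -- F_i^{(q-1)/2} F_i^m F_{i+1}^{-m}.
  have ha' : ∀ x : Kˣ, x ∈ Subgroup.zpowers a⁻¹ := by simpa using ha
  have ho : orderOf a⁻¹ = Fintype.card K - 1 := by
    rw [orderOf_eq_card_of_forall_mem_zpowers ha', Nat.card_units, Nat.card_eq_fintype_card]
  have hu := IsCyclic.image_range_orderOf ha'
  rw [ho] at hu
  rw [← hu, Finset.sum_image]
  · refine Finset.sum_congr rfl fun m _ => ?_
    rw [← map_pow, ← map_pow, ← map_pow, ← map_mul, ← map_mul]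
    refine congrArg (diagHom n K) (funext fun l => ?_)
    simp only [bruhatDiag, Pi.mul_apply, Pi.pow_apply, Pi.inv_apply, Pi.mulSingle_apply]
    rcases eq_or_ne l i with rfl | hi
    · simp [hne, pow_half_eq_neg_one hq ha]
    · rcases eq_or_ne l j with rfl | hj
      · simp [hi]
      · simp [hi, hj]
  · intro x hx y hy h
    refine pow_injOn_Iio_orderOf ?_ ?_ h
    · simpa [ho] using hx
    · simpa [ho] using hy

end

/-! ### The quadratic relation and the relations with N -/

section

variable {n : ℕ} {K : Type*} [Field K] [Fintype K]

theorem T_swap_sq [Fintype Kˣ] (hq : Odd (Fintype.card K)) {a : Kˣ}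
    (ha : ∀ x : Kˣ, x ∈ Subgroup.zpowers a) {i j : Fin n} (hij : i.val + 1 = j.val) {k : ℕ}
    (hk : k = j.val) :
    T (swap K i j) ^ 2 = (Fintype.card K : Ambient n K) + ((Fintype.card K : ℚ) - 1) •
      (genF n a k ^ ((Fintype.card K - 1) / 2) * elemE n a k * T (swap K i j)) := by
  have h : ¬ RowAscent (swap K i j) i j := by
    intro h
    obtain ⟨m, hm, hm'⟩ := h i (by rw [swap_ne_zero_iff, Equiv.swap_apply_right])
    rw [swap_ne_zero_iff, Equiv.swap_apply_left] at hm'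
    rw [← hm', Fin.lt_def] at hm
    omega
  rw [pow_two, T_swap_mul_of_not_rowAscent hij (swap_mem_rookMonoid i j) h, swap_mul_self, T_one,
    ← Finset.sum_mul, sum_bruhatDiag hq ha hij hk, smul_mul_assoc]
  congr 1
  rw [Nat.cast_smul_eq_nsmul, nsmul_one]

theorem T_swap_mul_diagHom {i j : Fin n} (hij : i.val + 1 = j.val) (k : Fin n) (a : Kˣ) :
    T (swap K i j) * diagHom n K (Pi.mulSingle k a) =
      diagHom n K (Pi.mulSingle (Equiv.swap i j k) a) * T (swap K i j) := by
  change T _ * T (dMat _) = T (dMat _) * T _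
  rw [T_dMat, T_dMat, T_swap_eq hij, smul_mul_assoc, mul_smul_comm,
    bi_mul_bi_of_right (fun u hu => mul_dMat_eq _ hu),
    bi_mul_bi_of_left (dMat_mem_leftAbsorbing _), swap_mul_dMat, mulSingle_comp_swap]

theorem genN_pow (hn : 0 < n) (m : ℕ) : genN n K ^ m = bi (nuMat n K ^ m) := by
  induction m with
  | zero => rw [pow_zero, pow_zero, bi_one]
  | succ m ih => rw [pow_succ', ih, genN_eq hn, bi_mul_bi_of_left nuMat_mem_leftAbsorbing, pow_succ']

theorem diagHom_mul_genN (hn : 0 < n) (d : Fin n → Kˣ) :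
    diagHom n K d * genN n K = bi (dMat d * nuMat n K) := by
  change T (dMat d) * _ = _
  rw [T_dMat, genN_eq hn, bi_mul_bi_of_left (dMat_mem_leftAbsorbing d)]

theorem genN_mul_diagHom (hn : 0 < n) (d : Fin n → Kˣ) :
    genN n K * diagHom n K d = bi (nuMat n K * dMat d) := by
  change _ * T (dMat d) = _
  rw [T_dMat, genN_eq hn, bi_mul_bi_of_left nuMat_mem_leftAbsorbing]

theorem diagHom_mul_genN_comm (a : Kˣ) {i j : Fin n} (hij : i.val + 1 = j.val) :
    diagHom n K (Pi.mulSingle i a) * genN n K = genN n K * diagHom n K (Pi.mulSingle j a) := by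
  have hn : 0 < n := i.pos
  rw [diagHom_mul_genN hn, genN_mul_diagHom hn]
  congr 1
  ext k l
  rw [dMat_mul_apply, mul_dMat_apply, nuMat, of_apply]
  split_ifs with h
  · have e : k = i ↔ l = j := by
      simp only [Fin.ext_iff]
      omega
    simp only [Pi.mulSingle_apply, e, one_mul, mul_one]
  · rw [zero_mul, mul_zero]

theorem genN_mul_diagHom_first (a : Kˣ) {i : Fin n} (hi : i.val = 0) :
    genN n K * diagHom n K (Pi.mulSingle i a) = genN n K := by
  have hn : 0 < n := i.pos
  rw [genN_mul_diagHom hn, genN_eq hn]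
  congr 1
  ext k l
  rw [mul_dMat_apply, nuMat, of_apply]
  split_ifs with h
  · rw [Pi.mulSingle_eq_of_ne (by rintro rfl; omega), Units.val_one, mul_one]
  · rw [zero_mul]

theorem diagHom_last_mul_genN (a : Kˣ) {i : Fin n} (hi : i.val + 1 = n) :
    diagHom n K (Pi.mulSingle i a) * genN n K = genN n K := by
  have hn : 0 < n := i.pos
  rw [diagHom_mul_genN hn, genN_eq hn]
  congr 1
  ext k l
  rw [dMat_mul_apply, nuMat, of_apply]
  split_ifs with h
  · rw [Pi.mulSingle_eq_of_ne (by rintro rfl; omega), Units.val_one, mul_one]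
  · rw [mul_zero]

/-- The first m columns of ν^m vanish, so exchanging columns i and j changes nothing, and only the
factor `scal (swap K i j)` = q remains. -/
theorem genN_pow_mul_T_swap {i j : Fin n} (hij : i.val + 1 = j.val) {m : ℕ} (hm : j.val < m) :
    genN n K ^ m * T (swap K i j) = (Fintype.card K : ℚ) • genN n K ^ m := by
  rw [genN_pow i.pos, T_swap_eq hij, mul_smul_comm,
    bi_mul_bi_of_left (pow_mem nuMat_mem_leftAbsorbing m)]
  congr 2
  ext k l
  rw [mul_swap_apply, nuMat_pow_apply, nuMat_pow_apply]
  congr 1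
  simp only [Equiv.swap_apply_def, eq_iff_iff, Fin.ext_iff]
  split_ifs <;> omega

/-- The last m rows of ν^m vanish, among them rows i and j: the ascent condition is vacuous and the
exchange is trivial. -/
theorem T_swap_mul_genN_pow {i j : Fin n} (hij : i.val + 1 = j.val) {m : ℕ}
    (hm : n ≤ i.val + m) :
    T (swap K i j) * genN n K ^ m = (Fintype.card K : ℚ) • genN n K ^ m := by
  rw [genN_pow i.pos, T_swap_eq hij, smul_mul_assoc,
    bi_swap_mul_bi_of_rowAscent hij (pow_mem nuMat_mem_rookMonoid m)]
  · congr 2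
    ext k l
    rw [swap_mul_apply, nuMat_pow_apply, nuMat_pow_apply]
    congr 1
    simp only [Equiv.swap_apply_def, eq_iff_iff, Fin.ext_iff]
    split_ifs <;> omega
  · refine rowAscent_of_eq_zero fun l => ?_
    rw [nuMat_pow_apply, if_neg]
    omega

theorem T_swap_mul_genN {i j k : Fin n} (hij : i.val + 1 = j.val) (hjk : j.val + 1 = k.val) :
    T (swap K i j) * genN n K = genN n K * T (swap K j k) := by
  have hnu : ∀ p r : Fin n, nuMat n K p r ≠ 0 ↔ p.val + 1 = r.val := by
    intro p r
    simp [nuMat]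
  rw [genN_eq i.pos, T_swap_eq hij, T_swap_eq hjk, smul_mul_assoc, mul_smul_comm,
    bi_swap_mul_bi_of_rowAscent hij nuMat_mem_rookMonoid,
    bi_mul_bi_of_left nuMat_mem_leftAbsorbing]
  · congr 2
    ext p r
    rw [swap_mul_apply, mul_swap_apply, nuMat, of_apply, of_apply]
    congr 1
    simp only [Equiv.swap_apply_def, eq_iff_iff, Fin.ext_iff]
    split_ifs <;> omega
  · refine rowAscent_of_lt (p := j) ((hnu _ _).2 hij) fun l hl => ?_
    rw [hnu] at hl
    rw [Fin.lt_def]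
    omega

theorem prod_genT_mul_bi_etaMat {m : ℕ} (hm : m < n) :
    ((List.range m).map fun k => genT n K (k + 1)).prod * bi (etaMat n K m) =
      (Fintype.card K : ℚ) ^ m • bi (etaMat n K 0) := by
  induction m with
  | zero => simp
  | succ m ih =>
    have hij : (⟨m, by omega⟩ : Fin n).val + 1 = (⟨m + 1, hm⟩ : Fin n).val := rfl
    have h := swap_mul_etaMat (K := K) hij
    have h' := bi_swap_mul_bi_of_rowAscent hij (etaMat_mem_rookMonoid (n := n) (K := K) (m + 1))
      (rowAscent_of_eq_zero fun l => by
        by_contra h0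
        rcases etaMat_ne_zero_iff.1 h0 with h | h
        · exact lt_irrefl _ h.1
        · exact lt_irrefl _ h.1)
    rw [List.range_succ, List.map_append, List.prod_append, List.map_singleton,
      List.prod_singleton, genT_eq hij rfl, mul_assoc, T_swap_eq hij, smul_mul_assoc, h', h,
      mul_smul_comm, ih (by omega), smul_smul, pow_succ']

theorem genN_mul_prod_genT_mul_genN (hn : 0 < n) :
    genN n K * ((List.range (n - 1)).map fun k => genT n K (k + 1)).prod * genN n K =
      (Fintype.card K : ℚ) ^ (n - 1) • genN n K := by
  have h := prod_genT_mul_bi_etaMat (n := n) (K := K) (m := n - 1) (by omega)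
  rw [etaMat_last] at h
  rw [mul_assoc, genN_eq hn, h, mul_smul_comm, bi_mul_bi_of_left nuMat_mem_leftAbsorbing,
    nuMat_mul_etaMat_zero]

end

/-! ### Generation of the framed rook algebra -/

section

variable {n : ℕ} {K : Type*} [Field K]

/-- The matrix with first row `E_{1,p}` above the rows of `σ` shifted down by one. -/
def consRow (p : Fin n) (σ : Matrix (Fin n) (Fin n) K) : Matrix (Fin n) (Fin n) K :=
  of fun k l => if k.val = 0 then if l = p then 1 else 0 else σ ⟨k.val - 1, by omega⟩ l

theorem consRow_ne_zero {p : Fin n} {σ : Matrix (Fin n) (Fin n) K} {k l : Fin n}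
    (h : consRow p σ k l ≠ 0) :
    (k.val = 0 ∧ l = p) ∨ ∃ m : Fin n, m.val + 1 = k.val ∧ σ m l ≠ 0 := by
  rw [consRow, of_apply] at h
  by_cases hk : k.val = 0
  · rw [if_pos hk] at h
    exact Or.inl ⟨hk, by_contra fun h0 => h (if_neg h0)⟩
  · rw [if_neg hk] at h
    exact Or.inr ⟨_, by simp only; omega, h⟩

theorem consRow_mem_rookMonoid {p : Fin n} {σ : Matrix (Fin n) (Fin n) K}
    (hσ : σ ∈ rookMonoid n K) (hp : ∀ k, σ k p = 0) : consRow p σ ∈ rookMonoid n K := by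
  refine ⟨fun k l l' h h' => ?_, fun k k' l h h' => ?_⟩
  · rcases consRow_ne_zero h with ⟨h1, h2⟩ | ⟨m, hm, h1⟩ <;>
      rcases consRow_ne_zero h' with ⟨h1', h2'⟩ | ⟨m', hm', h1'⟩
    · exact h2.trans h2'.symm
    · omega
    · omega
    · obtain rfl : m = m' := Fin.ext (by omega)
      exact hσ.1 _ _ _ h1 h1'
  · rcases consRow_ne_zero h with ⟨h1, h2⟩ | ⟨m, hm, h1⟩ <;>
      rcases consRow_ne_zero h' with ⟨h1', h2'⟩ | ⟨m', hm', h1'⟩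
    · exact Fin.ext (by omega)
    · exact absurd (h2 ▸ hp m') h1'
    · exact absurd (h2' ▸ hp m) h1
    · obtain rfl := hσ.2 _ _ _ h1 h1'
      exact Fin.ext (by omega)

theorem nuMat_mul_consRow {p : Fin n} {σ : Matrix (Fin n) (Fin n) K}
    (h : ∀ k : Fin n, k.val + 1 = n → ∀ l, σ k l = 0) : nuMat n K * consRow p σ = σ := by
  ext i l
  rw [nuMat_mul_apply]
  split_ifs with hi
  · rw [consRow, of_apply, if_neg (by simp)]
    rfl
  · rw [h i (by omega)]

/-- An ascent above a nonzero row forces a nonzero row with its entry further left. Starting from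
the nonzero last row, all n rows are nonzero with strictly increasing columns, so the entries lie on
the diagonal. -/
theorem eq_dMat_of_rowAscent {σ : Matrix (Fin n) (Fin n) K} (hσ : σ ∈ rookMonoid n K)
    (h : ∀ i j : Fin n, i.val + 1 = j.val → RowAscent σ i j)
    (hl : ∃ k : Fin n, k.val + 1 = n ∧ ∃ l, σ k l ≠ 0) : ∃ d, σ = dMat d := by
  have h1 : ∀ m, ∀ i l : Fin n, i.val = m → σ i l ≠ 0 → i ≤ l := by
    intro m
    induction m with
    | zero =>
      intro i l hi _
      rw [Fin.le_def]
      omega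
    | succ m ih =>
      intro i l hi hil
      obtain ⟨r, hr, hr'⟩ := h ⟨m, by omega⟩ i hi.symm l hil
      have := ih _ _ rfl hr'
      rw [Fin.le_def] at this ⊢
      rw [Fin.lt_def] at hr
      simp only at this
      omega
  have h2 : ∀ m, ∀ i : Fin n, i.val + 1 + m = n → σ i i ≠ 0 := by
    intro m
    induction m with
    | zero =>
      intro i hi
      obtain ⟨k, hk, l, hkl⟩ := hl
      obtain rfl : k = i := Fin.ext (by omega)
      have := h1 _ _ _ rfl hkl
      rw [Fin.le_def] at this
      obtain rfl : k = l := Fin.ext (by omega)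
      exact hkl
    | succ m ih =>
      intro i hi
      obtain ⟨r, hr, hr'⟩ := h i ⟨i.val + 1, by omega⟩ rfl _ (ih _ (by simp only; omega))
      have := h1 _ _ _ rfl hr'
      rw [Fin.le_def] at this
      rw [Fin.lt_def] at hr
      simp only at hr
      obtain rfl : i = r := Fin.ext (by omega)
      exact hr'
  have h3 : ∀ i, σ i i ≠ 0 := fun i => h2 (n - (i.val + 1)) i (by omega)
  refine ⟨fun i => Units.mk0 _ (h3 i), ?_⟩
  ext i j
  rw [dMat, diagonal_apply]
  split_ifs with hij
  · subst hij
    rfl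
  · by_contra h0
    exact hij (hσ.1 _ _ _ (h3 i) h0)

variable [Fintype K]

/-- A subring containing the `T_s`, the `T_d` for invertible diagonal `d` and `N` contains every
`T_σ`. -/
theorem T_mem_of_generators (hn : 0 < n) {A : Subalgebra ℤ (Ambient n K)}
    (hT : ∀ i j : Fin n, i.val + 1 = j.val → T (swap K i j) ∈ A)
    (hD : ∀ d, diagHom n K d ∈ A) (hN : genN n K ∈ A)
    {σ : Matrix (Fin n) (Fin n) K} (hσ : σ ∈ rookMonoid n K) : T σ ∈ A := by
  -- Lexicographic induction on corank, then on the size of the reach: removing N lowers the corank,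
  -- and removing a transposition keeps the rank and lowers the reach.
  suffices H : ∀ N R, ∀ σ ∈ rookMonoid n K, n - σ.rank = N → (reach σ).card = R → T σ ∈ A from
    H _ _ σ hσ rfl rfl
  intro N
  induction N using Nat.strong_induction_on with
  | _ N ihN =>
  intro R
  induction R using Nat.strong_induction_on with
  | _ R ihR =>
  intro σ hσ hN' hR
  by_cases hlast : ∀ k : Fin n, k.val + 1 = n → ∀ l, σ k l = 0
  · obtain ⟨c, hc⟩ := exists_zero_col hσ (hlast ⟨n - 1, by omega⟩ (by simp only; omega))
    classical
    -- Taking the rightmost zero column leaves only nonzero columns to its right, which is the case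
    -- where multiplication by N introduces no power of q.
    obtain ⟨p, hp, hmax⟩ := (Finset.univ.filter fun j => ∀ k, σ k j = 0).exists_max_image id
      ⟨c, by simpa using hc⟩
    have hp : ∀ k, σ k p = 0 := by simpa using hp
    have hτ := consRow_mem_rookMonoid hσ hp
    have e := nuMat_mul_consRow (p := p) hlast
    have h0 : consRow p σ ⟨0, hn⟩ p ≠ 0 := by simp [consRow]
    have hr : ∀ j, p < j → ∃ k, consRow p σ k j ≠ 0 := by
      intro j hj
      have hj' : ¬ ∀ k, σ k j = 0 := fun h => not_le.2 hj (hmax j (by simpa using h))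
      push Not at hj'
      obtain ⟨k, hk⟩ := hj'
      have hkn : k.val + 1 < n := by
        by_contra h
        exact hk (hlast k (by omega) j)
      refine ⟨⟨k.val + 1, hkn⟩, ?_⟩
      rw [consRow, of_apply, if_neg (by simp)]
      exact hk
    have h1 := (rank_and_card_reach_nuMat_mul hn hτ h0 hr).1
    have h2 := genN_mul_T_of_ne_zero hn hτ h0 hr
    rw [e] at h1 h2
    rw [← h2]
    have h3 := rank_le_width (consRow p σ)
    exact mul_mem hN (ihN _ (by omega) _ _ hτ rfl rfl)
  by_cases hasc : ∀ i j : Fin n, i.val + 1 = j.val → RowAscent σ i j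
  · push Not at hlast
    obtain ⟨d, rfl⟩ := eq_dMat_of_rowAscent hσ hasc hlast
    exact hD d
  · push Not at hasc
    obtain ⟨i, j, hij, h⟩ := hasc
    have h1 := rowAscent_swap_mul hσ (Fin.ne_of_val_ne (by omega)) h
    have hτ := mul_mem (swap_mem_rookMonoid i j) hσ
    have hss : swap K i j * (swap K i j * σ) = σ := by
      rw [← mul_assoc, swap_mul_self, one_mul]
    unfold RowAscent at h
    push Not at h
    obtain ⟨p, hp, -⟩ := h
    have hp' : (swap K i j * σ) i p ≠ 0 := by rwa [swap_mul_apply, Equiv.swap_apply_left]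
    have h2 := T_swap_mul_of_rowAscent hij hτ hp' h1
    have h3 := card_reach_swap_mul hij hτ hp' fun l hl => by
      obtain ⟨m, hm, hm'⟩ := h1 l hl
      rwa [hτ.1 _ _ _ hp' hm']
    rw [hss] at h2 h3
    rw [← h2]
    exact mul_mem (hT i j hij) (ihR _ (by omega) _ hτ (by rw [rank_swap_mul, hN']) rfl)

theorem T_mem_framedRook {σ : Matrix (Fin n) (Fin n) K} (hσ : σ ∈ rookMonoid n K) :
    T σ ∈ framedRook n K :=
  Submodule.subset_span ⟨σ, hσ, rfl⟩

theorem natCast_smul_mem_framedRook {x : Ambient n K} (hx : x ∈ framedRook n K) (c : ℕ) :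
    (c : ℚ) • x ∈ framedRook n K := by
  rw [Nat.cast_smul_eq_nsmul]
  exact nsmul_mem hx c

theorem mul_mem_framedRook {g : Ambient n K}
    (hg : ∀ σ ∈ rookMonoid n K, g * T σ ∈ framedRook n K) {x : Ambient n K}
    (hx : x ∈ framedRook n K) : g * x ∈ framedRook n K := by
  induction hx using Submodule.span_induction with
  | mem x hx =>
    obtain ⟨σ, hσ, rfl⟩ := hx
    exact hg σ hσ
  | zero =>
    rw [mul_zero]
    exact zero_mem _
  | add x y _ _ hx hy =>
    rw [mul_add]
    exact add_mem hx hy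
  | smul c x _ hx =>
    rw [mul_smul_comm]
    exact Submodule.smul_mem _ c hx

theorem T_swap_mul_mem_framedRook {i j : Fin n} (hij : i.val + 1 = j.val)
    {σ : Matrix (Fin n) (Fin n) K} (hσ : σ ∈ rookMonoid n K) :
    T (swap K i j) * T σ ∈ framedRook n K := by
  have hτ := mul_mem (swap_mem_rookMonoid (K := K) i j) hσ
  by_cases h : RowAscent σ i j
  · by_cases hi : ∃ p, σ i p ≠ 0
    · obtain ⟨p, hp⟩ := hi
      rw [T_swap_mul_of_rowAscent hij hσ hp h]
      exact T_mem_framedRook hτ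
    -- An ascent with row i zero forces row j to be zero as well, so the transposition fixes σ and
    -- `T` of it acts as q.
    · push Not at hi
      have hj : ∀ l, σ j l = 0 := by
        intro l
        by_contra h0
        obtain ⟨m, -, hm⟩ := h l h0
        exact hm (hi m)
      have e : swap K i j * σ = σ := by
        ext k l
        rw [swap_mul_apply]
        rcases eq_or_ne k i with rfl | hki
        · rw [Equiv.swap_apply_left, hi, hj]
        rcases eq_or_ne k j with rfl | hkj
        · rw [Equiv.swap_apply_right, hi, hj]
        · rw [Equiv.swap_apply_of_ne_of_ne hki hkj]
      rw [T_swap_mul_of_swap_mul_eq hij hσ h e]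
      exact natCast_smul_mem_framedRook (T_mem_framedRook hσ) _
  · classical
    rw [T_swap_mul_of_not_rowAscent hij hσ h]
    refine add_mem (natCast_smul_mem_framedRook (T_mem_framedRook hτ) _)
      (sum_mem fun b _ => ?_)
    rw [T_dMat_mul _ hσ]
    exact T_mem_framedRook (mul_mem (dMat_mem_rookMonoid _) hσ)

theorem genN_mul_mem_framedRook (hn : 0 < n) {σ : Matrix (Fin n) (Fin n) K}
    (hσ : σ ∈ rookMonoid n K) : genN n K * T σ ∈ framedRook n K := by
  obtain ⟨e, he⟩ := genN_mul_T hn hσ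
  rw [he, ← Nat.cast_pow]
  exact natCast_smul_mem_framedRook (T_mem_framedRook (mul_mem nuMat_mem_rookMonoid hσ)) _

/-- The elements whose left multiplication preserves the span form a subalgebra, and the span
contains 1. So checking generators against the `T σ` suffices, and closure under products need not
be known beforehand. -/
theorem adjoin_le_framedRook {S : Set (Ambient n K)}
    (hS : ∀ g ∈ S, ∀ σ ∈ rookMonoid n K, g * T σ ∈ framedRook n K) :
    Subalgebra.toSubmodule (Algebra.adjoin ℤ S) ≤ framedRook n K := by
  intro x hx
  replace hx : x ∈ Algebra.adjoin ℤ S := hx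
  have key : ∀ y ∈ framedRook n K, x * y ∈ framedRook n K := by
    induction hx using Algebra.adjoin_induction with
    | mem g hg => exact fun y hy => mul_mem_framedRook (hS g hg) hy
    | algebraMap c =>
      intro y hy
      rw [← Algebra.smul_def]
      exact Submodule.smul_mem _ c hy
    | add u v _ _ hu hv =>
      intro y hy
      rw [add_mul]
      exact add_mem (hu y hy) (hv y hy)
    | mul u v _ _ hu hv =>
      intro y hy
      rw [mul_assoc]
      exact hu _ (hv y hy)
  have h := key 1 (by rw [← T_one]; exact T_mem_framedRook (one_mem _))
  rwa [mul_one] at h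

/-- Since Kˣ is finite, nonnegative powers of a exhaust it, so no inverses are required in the
subalgebra. -/
theorem diagHom_mem_of_generators {a : Kˣ} (ha : ∀ x : Kˣ, x ∈ Subgroup.zpowers a)
    {A : Subalgebra ℤ (Ambient n K)} (hF : ∀ i, diagHom n K (Pi.mulSingle i a) ∈ A)
    (d : Fin n → Kˣ) : diagHom n K d ∈ A := by
  rw [← Finset.univ_prod_mulSingle d]
  change _ ∈ A.toSubmonoid.comap (diagHom n K)
  refine prod_mem fun i _ => ?_
  obtain ⟨m, hm⟩ := mem_powers_iff_mem_zpowers.2 (ha (d i))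
  rw [← show a ^ m = d i from hm, Pi.mulSingle_pow]
  exact pow_mem (show Pi.mulSingle i a ∈ A.toSubmonoid.comap (diagHom n K) from hF i) m

theorem adjoin_eq_framedRook {a : Kˣ} (ha : ∀ x : Kˣ, x ∈ Subgroup.zpowers a) (hn : 0 < n) :
    Subalgebra.toSubmodule (Algebra.adjoin ℤ
        (genT n K '' Set.Icc 1 (n - 1) ∪ genF n a '' Set.Icc 1 n ∪ {genN n K})) =
      framedRook n K := by
  apply le_antisymm
  · refine adjoin_le_framedRook ?_
    rintro g ((⟨k, ⟨hk1, hk2⟩, rfl⟩ | ⟨k, ⟨hk1, hk2⟩, rfl⟩) | rfl) σ hσ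
    · have hij : (⟨k - 1, by omega⟩ : Fin n).val + 1 = (⟨k, by omega⟩ : Fin n).val := by
        simp only
        omega
      rw [genT_eq hij rfl]
      exact T_swap_mul_mem_framedRook hij hσ
    · rw [genF_eq a (i := ⟨k - 1, by omega⟩) (by simp only; omega)]
      change T _ * _ ∈ _
      rw [T_dMat_mul _ hσ]
      exact T_mem_framedRook (mul_mem (dMat_mem_rookMonoid _) hσ)
    · exact genN_mul_mem_framedRook hn hσ
  · refine Submodule.span_le.2 ?_
    rintro _ ⟨σ, hσ, rfl⟩
    refine T_mem_of_generators hn (fun i j hij => ?_) (diagHom_mem_of_generators ha fun i => ?_)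
      (Algebra.subset_adjoin (Or.inr rfl)) hσ
    · refine Algebra.subset_adjoin (Or.inl (Or.inl ⟨j.val, ⟨by omega, by omega⟩, ?_⟩))
      exact genT_eq hij rfl
    · refine Algebra.subset_adjoin (Or.inl (Or.inr ⟨i.val + 1, ⟨by omega, by omega⟩, ?_⟩))
      exact genF_eq a rfl

end

end

end FramedRook

theorem mainTheorem9 (K : Type*) [Field K] [Fintype K] (hq : Odd (Fintype.card K))
    (a : Kˣ) (ha : ∀ x : Kˣ, x ∈ Subgroup.zpowers a) (n : ℕ) (hn : 0 < n) :
    let q : ℕ := Fintype.card K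
    let T : ℕ → FramedRook.Ambient n K := FramedRook.genT n K
    let F : ℕ → FramedRook.Ambient n K := FramedRook.genF n a
    let N : FramedRook.Ambient n K := FramedRook.genN n K
    let E : ℕ → FramedRook.Ambient n K := FramedRook.elemE n a
    -- `H(M,U)` is a ring with unit `T_1`, generated by the `T_i`, the `F_i` and `N`
    FramedRook.T (1 : Matrix (Fin n) (Fin n) K) = 1 ∧
    Subalgebra.toSubmodule
        (Algebra.adjoin ℤ (T '' Set.Icc 1 (n - 1) ∪ F '' Set.Icc 1 n ∪ {N})) =
      FramedRook.framedRook n K ∧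
    -- braid relations
    (∀ i ∈ Set.Icc 1 (n - 1), ∀ j ∈ Set.Icc 1 (n - 1), |(i : ℤ) - j| = 1 →
      T i * T j * T i = T j * T i * T j) ∧
    (∀ i ∈ Set.Icc 1 (n - 1), ∀ j ∈ Set.Icc 1 (n - 1), 1 < |(i : ℤ) - j| →
      T i * T j = T j * T i) ∧
    -- framing relations
    (∀ i ∈ Set.Icc 1 n, F i ^ (q - 1) = 1) ∧
    (∀ i ∈ Set.Icc 1 n, ∀ j ∈ Set.Icc 1 n, F i * F j = F j * F i) ∧
    -- quadratic and mixed relations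
    (∀ i ∈ Set.Icc 1 (n - 1),
      T i ^ 2 = (q : FramedRook.Ambient n K) + ((q : ℚ) - 1) • (F i ^ ((q - 1) / 2) * E i * T i)) ∧
    (∀ i ∈ Set.Icc 1 (n - 1), ∀ j ∈ Set.Icc 1 n,
      T i * F j = F (Equiv.swap i (i + 1) j) * T i) ∧
    -- relations between the `F_i` and `N`
    (∀ i ∈ Set.Icc 1 n, i < n → F i * N = N * F (i + 1)) ∧
    N * F 1 = N ∧ F n * N = N ∧
    -- relations between the `T_i` and `N`
    (∀ i ∈ Set.Icc 1 (n - 1), N ^ (i + 1) * T i = (q : ℚ) • N ^ (i + 1)) ∧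
    (∀ i ∈ Set.Icc 1 (n - 1), T i * N ^ (n - i + 1) = (q : ℚ) • N ^ (n - i + 1)) ∧
    (∀ i ∈ Set.Icc 1 (n - 1), i + 1 ∈ Set.Icc 1 (n - 1) → T i * N = N * T (i + 1)) ∧
    N * ((List.range (n - 1)).map fun k => T (k + 1)).prod * N = (q : ℚ) ^ (n - 1) • N := by
  classical
  intro q T F N E
  -- Passage from the numbering from 1 to positions in `Fin n`: T_i exchanges positions i - 1 and i,
  -- while F_i acts at position i - 1.
  have hT : ∀ i ∈ Set.Icc 1 (n - 1), ∃ k l : Fin n, k.val + 1 = l.val ∧ i = l.val ∧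
      T i = FramedRook.T (Matrix.swap K k l) := by
    rintro i ⟨h1, h2⟩
    have h : (⟨i - 1, by omega⟩ : Fin n).val + 1 = (⟨i, by omega⟩ : Fin n).val := by
      simp only
      omega
    exact ⟨_, _, h, rfl, FramedRook.genT_eq h rfl⟩
  have hF : ∀ i ∈ Set.Icc 1 n, ∃ k : Fin n, i = k.val + 1 := fun i hi =>
    ⟨⟨i - 1, by have := hi.1; have := hi.2; omega⟩, by have := hi.1; simp only; omega⟩
  have hF' : ∀ k : Fin n, F (k.val + 1) = FramedRook.diagHom n K (Pi.mulSingle k a) :=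
    fun k => FramedRook.genF_eq a rfl
  refine ⟨FramedRook.T_one, FramedRook.adjoin_eq_framedRook ha hn, ?_, ?_, ?_, ?_, ?_, ?_, ?_, ?_,
    ?_, ?_, ?_, ?_, FramedRook.genN_mul_prod_genT_mul_genN hn⟩
  · intro i hi j hj hij
    obtain ⟨k, l, hkl, rfl, e⟩ := hT i hi
    obtain ⟨k', l', hkl', rfl, e'⟩ := hT j hj
    rw [e, e']
    rcases (abs_eq zero_le_one).1 hij with h | h
    · obtain rfl : k = l' := Fin.ext (by omega)
      exact (FramedRook.T_braid hkl' hkl).symm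
    · obtain rfl : l = k' := Fin.ext (by omega)
      exact FramedRook.T_braid hkl hkl'
  · intro i hi j hj hij
    obtain ⟨k, l, hkl, rfl, e⟩ := hT i hi
    obtain ⟨k', l', hkl', rfl, e'⟩ := hT j hj
    rw [e, e']
    rw [lt_abs] at hij
    refine FramedRook.T_swap_comm hkl hkl' ?_ ?_ ?_ ?_ <;>
    · refine Fin.ne_of_val_ne ?_
      omega
  · intro i hi
    obtain ⟨k, rfl⟩ := hF i hi
    rw [hF', ← map_pow, ← Pi.mulSingle_pow]
    have : a ^ (q - 1) = 1 := by
      rw [← Fintype.card_units, pow_card_eq_one]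
    rw [this, Pi.mulSingle_one, map_one]
  · intro i hi j hj
    obtain ⟨k, rfl⟩ := hF i hi
    obtain ⟨l, rfl⟩ := hF j hj
    rw [hF', hF', ← map_mul, mul_comm, map_mul]
  · intro i hi
    obtain ⟨k, l, hkl, hil, e⟩ := hT i hi
    rw [e]
    exact FramedRook.T_swap_sq hq ha hkl hil
  · intro i hi j hj
    obtain ⟨k, l, hkl, rfl, e⟩ := hT i hi
    obtain ⟨m, rfl⟩ := hF j hj
    have h : Equiv.swap l.val (l.val + 1) (m.val + 1) = (Equiv.swap k l m).val + 1 := by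
      simp only [Equiv.swap_apply_def, Fin.ext_iff]
      split_ifs <;> omega
    rw [e, h, hF', hF', FramedRook.T_swap_mul_diagHom hkl]
  · intro i hi hin
    obtain ⟨k, rfl⟩ := hF i hi
    rw [hF', hF' ⟨k.val + 1, hin⟩]
    exact FramedRook.diagHom_mul_genN_comm a rfl
  · rw [show F 1 = _ from hF' ⟨0, hn⟩]
    exact FramedRook.genN_mul_diagHom_first a rfl
  · obtain ⟨k, hk⟩ := hF n ⟨hn, le_rfl⟩
    have h : F n = _ := FramedRook.genF_eq a hk
    rw [h]
    exact FramedRook.diagHom_last_mul_genN a hk.symm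
  · intro i hi
    obtain ⟨k, l, hkl, rfl, e⟩ := hT i hi
    rw [e]
    exact FramedRook.genN_pow_mul_T_swap hkl (Nat.lt_succ_self _)
  · intro i hi
    obtain ⟨k, l, hkl, rfl, e⟩ := hT i hi
    rw [e]
    exact FramedRook.T_swap_mul_genN_pow hkl (by omega)
  · intro i hi hi'
    obtain ⟨k, l, hkl, rfl, e⟩ := hT i hi
    obtain ⟨k', l', hkl', h, e'⟩ := hT _ hi'
    obtain rfl : l = k' := Fin.ext (by omega)
    rw [e, e']
    exact FramedRook.T_swap_mul_genN hkl hkl'
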